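/- Let $d\in\mathbb N$ and $1<p<\infty$. Let $\mathcal M_p$ be the set of Borel probability measures on $\mathbb R^d$ with finite $p$-th moment, endowed with the Wasserstein metric $$W_p(\mu,\nu)=\inf_\pi\Big(\iint|x-y|^p\,d\pi(x,y)\Big)^{1/p},$$ the infimum being over all couplings $\pi$ of $\mu$ and $\nu$. For $t\ge 0$, $AC_p([0,t],\mathcal M_p)$ is the set of paths $\sigma:[0,t]\to\mathcal M_p$ for which there is $h\in L^p([0,t])$ with $W_p(\sigma(s_1),\sigma(s_2))\le\int_{s_1}^{s_2}h(u)\,du$ whenever $0\le s_1\le s_2\le t$; the (almost everywhere) smallest such $h$ is the metric derivative $\|\dot\sigma\|$. Let $C_p$ be the best (smallest) constant in the Poincaré inequality $$\Big(\int_0^{S}W_p(\sigma(s),\sigma(S))^p\,ds\Big)^{1/p}\le C_p\,S\Big(\int_0^{S}\|\dot\sigma(s)\|^p\,ds\Big)^{1/p},\qquad S>0,\ \sigma\in AC_p([0,S],\mathcal M_p).$$ Let $\mathcal G:\mathcal M_p\to\mathbb R$ be Lipschitz continuous with respect to $W_p$, and let $\mathcal V:\mathcal M_p\to\mathbb R$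 satisfy, for some $\alpha,\beta\in\mathbb R$ and $\varrho\in\mathcal M_p$, $$\mathcal V(\mu)\le\alpha W_p(\mu,\varrho)^p+\beta\qquad\text{for all }\mu\in\mathcal M_p.$$ For $(\mu,t)\in\mathcal M_p\times[0,\infty)$ put $$\mathcal U(\mu,t)=\inf\Big\{\mathcal G(\sigma(0))+\int_0^t\Big(\tfrac1p\|\dot\sigma(s)\|^p-\mathcal V(\sigma(s))\Big)ds\ :\ \sigma\in AC_p([0,t],\mathcal M_p),\ \sigma(t)=\mu\Big\}\in[-\infty,\infty).$$ Suppose that $\mathcal G$ and $\mathcal V$ are continuous on $\mathcal M_p$ with respect to the narrow topology (convergence against bounded continuous functions), and that $T$ satisfies $p(2C_pT)^p\alpha<1$. Then for every $(\mu,t)\in\mathcal M_p\times[0,T]$ there is a minimizing path for $\mathcal U(\mu,t)$, that is, a path $\sigma\in AC_p([0,t],\mathcal M_p)$ with $\sigma(t)=\mu$ that attains the infimum. -/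

import Mathlib

open MeasureTheory Set
open scoped ENNReal

noncomputable section

/-- The set `𝒫_p(ℝ^d)` of Borel probability measures on `ℝ^d` with finite `p`-th moment. It is
declared as a `def` so that it carries no topology by default: the Wasserstein distance and the
narrow topology on it are always named explicitly below. -/
def WassersteinSpace (d : ℕ) (p : ℝ) : Type :=
  {μ : ProbabilityMeasure (EuclideanSpace ℝ (Fin d)) //
    ∫⁻ x, ‖x‖ₑ ^ p ∂(μ : Measure (EuclideanSpace ℝ (Fin d))) < ∞}

namespace WassersteinSpace

variable {d : ℕ} {p : ℝ}

/-- The underlying measure. -/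
def toMeasure (μ : WassersteinSpace d p) : Measure (EuclideanSpace ℝ (Fin d)) :=
  (μ.1 : Measure (EuclideanSpace ℝ (Fin d)))

/-- The couplings of `μ` and `ν`: measures on the product with marginals `μ` and `ν`. -/
def couplings (μ ν : WassersteinSpace d p) :
    Set (Measure (EuclideanSpace ℝ (Fin d) × EuclideanSpace ℝ (Fin d))) :=
  {π | π.map Prod.fst = μ.toMeasure ∧ π.map Prod.snd = ν.toMeasure}

/-- The `p`-Wasserstein distance. The infimum is taken in `[0, ∞]`; it is finite because the
measures have finite `p`-th moments. -/
def dist (μ ν : WassersteinSpace d p) : ℝ :=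
  (⨅ π ∈ couplings μ ν, (∫⁻ z, ‖z.1 - z.2‖ₑ ^ p ∂π) ^ (1 / p)).toReal

/-- Continuity of a functional on `𝒫_p(ℝ^d)` for the narrow topology, i.e. the topology of
convergence against bounded continuous functions. -/
def NarrowlyContinuous (F : WassersteinSpace d p → ℝ) : Prop :=
  @Continuous _ _
    (TopologicalSpace.induced
      (fun μ : WassersteinSpace d p =>
        (μ.1 : ProbabilityMeasure (EuclideanSpace ℝ (Fin d)))) inferInstance)
    inferInstance F

/-- Lipschitz continuity of a functional for the `p`-Wasserstein distance. -/
def IsLipschitz (F : WassersteinSpace d p → ℝ) : Prop :=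
  ∃ L : ℝ, ∀ μ ν, |F μ - F ν| ≤ L * dist μ ν

/-- `h ∈ L^p([0,t])` and `W_p(σ(s₁), σ(s₂)) ≤ ∫_{s₁}^{s₂} h` for `0 ≤ s₁ ≤ s₂ ≤ t`. -/
def IsSpeedBound (t : ℝ) (σ : ℝ → WassersteinSpace d p) (h : ℝ → ℝ) : Prop :=
  MemLp h (ENNReal.ofReal p) (volume.restrict (Icc 0 t)) ∧
    ∀ s₁ s₂, 0 ≤ s₁ → s₁ ≤ s₂ → s₂ ≤ t → dist (σ s₁) (σ s₂) ≤ ∫ u in s₁..s₂, h u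

/-- `σ ∈ AC_p([0,t], 𝓜_p)`. A path is given as a function on `ℝ`, of which only the restriction to
`[0,t]` matters. -/
def IsACPath (t : ℝ) (σ : ℝ → WassersteinSpace d p) : Prop :=
  ∃ h : ℝ → ℝ, IsSpeedBound t σ h

/-- `h` is the smallest (up to null sets) speed bound of `σ` on `[0,t]`. -/
def IsMetricDeriv (t : ℝ) (σ : ℝ → WassersteinSpace d p) (h : ℝ → ℝ) : Prop :=
  IsSpeedBound t σ h ∧
    ∀ g : ℝ → ℝ, IsSpeedBound t σ g → h ≤ᵐ[volume.restrict (Icc 0 t)] g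

open Classical in
/-- The metric derivative `‖σ'‖` of a path `σ ∈ AC_p([0,t], 𝓜_p)`: a representative of the smallest
speed bound, which exists for every such path and is unique up to null sets. -/
def metricDeriv (t : ℝ) (σ : ℝ → WassersteinSpace d p) : ℝ → ℝ :=
  if H : ∃ h : ℝ → ℝ, IsMetricDeriv t σ h then H.choose else 0

/-- The Poincaré inequality with constant `C` along all `p`-absolutely continuous paths:
`(∫_0^T W_p(σ(s), σ(T))^p ds)^{1/p} ≤ C T (∫_0^T ‖σ'(s)‖^p ds)^{1/p}`. -/
def PoincareInequality (d : ℕ) (p C : ℝ) : Prop :=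
  ∀ (T : ℝ) (σ : ℝ → WassersteinSpace d p), 0 < T → IsACPath T σ →
    (∫ s in (0 : ℝ)..T, dist (σ s) (σ T) ^ p) ^ (1 / p) ≤
      C * T * (∫ s in (0 : ℝ)..T, metricDeriv T σ s ^ p) ^ (1 / p)

/-- The constant `C_p`: the best constant in the Poincaré inequality (for `p ≥ 1` the set is
nonempty, and it contains its infimum unless that is `0`). -/
def poincareConst (d : ℕ) (p : ℝ) : ℝ :=
  sInf {C : ℝ | 0 < C ∧ PoincareInequality d p C}

/-- The action `𝓖(σ(0)) + ∫_0^t ((1/p) ‖σ'(s)‖^p - 𝓥(σ(s))) ds`. -/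
def action (G V : WassersteinSpace d p → ℝ) (t : ℝ) (σ : ℝ → WassersteinSpace d p) : ℝ :=
  G (σ 0) + ∫ s in (0 : ℝ)..t, (1 / p * metricDeriv t σ s ^ p - V (σ s))

/-- The admissible paths for `𝓤(μ,t)`. -/
def IsAdmissible (μ : WassersteinSpace d p) (t : ℝ) (σ : ℝ → WassersteinSpace d p) : Prop :=
  IsACPath t σ ∧ σ t = μ

/-- The generalized value function `𝓤(μ,t)`, an infimum in `[-∞, ∞]`. -/
def valueFunction (G V : WassersteinSpace d p → ℝ) (μ : WassersteinSpace d p) (t : ℝ) : EReal :=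
  ⨅ (σ : ℝ → WassersteinSpace d p) (_ : IsAdmissible μ t σ), (action G V t σ : EReal)

/-- `σ` is a minimizing path for `𝓤(μ,t)`: it is admissible and attains the infimum. -/
def IsMinimizingPath (G V : WassersteinSpace d p → ℝ) (μ : WassersteinSpace d p) (t : ℝ)
    (σ : ℝ → WassersteinSpace d p) : Prop :=
  IsAdmissible μ t σ ∧ (action G V t σ : EReal) = valueFunction G V μ t

end WassersteinSpace

end

/-! The proof is the direct method: the action is coercive in the energy `∫ ‖σ'‖^p`, and bounded
energy gives enough compactness for a limit path that does not increase the action.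

Coercivity (`exists_energy_le_action`): of the weight `1/p` on the energy, the Lipschitz term
`G(σ(0))` absorbs a quarter, and the growth of `V`, through the Poincaré inequality and the
smallness of `T`, absorbs a half. A quarter is left, up to a constant.

Compactness (`exists_admissible_action_le`): bounded energy and a fixed endpoint bound the moments
uniformly, so the paths stay in a narrowly compact set and converge at each time along an
ultrafilter. The term in `G` converges by narrow continuity. For `V`, narrow compactness turns
narrow continuity into uniform `W_p`-continuity on bounded moments; the integrands are then
equicontinuous in time and their integrals converge.

Lower semicontinuity of the energy (`exists_limit_speed`) avoids weak `L^p` compactness. The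
primitives of the speeds and of their `p`-th powers converge pointwise to `F` and `Φ`. The tangent
line inequality for `x ↦ x^p` makes `F` absolutely continuous and gives `(F')^p ≤ Φ'` almost
everywhere, while lower semicontinuity of `W_p` makes `F'` a speed bound for the limit path. -/

open Filter Topology NNReal ProbabilityTheory

/-! ### Narrow compactness of sets of bounded moment -/

section NarrowCompactness

variable {F : Type*} [MeasurableSpace F]

/-- Truncations at height `M` are bounded and continuous, so narrow convergence applies to them;
monotone convergence in `M` removes the truncation. -/
theorem MeasureTheory.ProbabilityMeasure.lintegral_le_of_tendsto [TopologicalSpace F]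
    [OpensMeasurableSpace F] {ι : Type*} {l : Filter ι} [l.NeBot]
    {P : ι → ProbabilityMeasure F} {Q : ProbabilityMeasure F} (hP : Tendsto P l (𝓝 Q))
    {f : F → ℝ≥0} (hf : Continuous f) {a : ι → ℝ≥0∞} {b : ℝ≥0∞} (ha : Tendsto a l (𝓝 b))
    (h : ∀ᶠ i in l, ∫⁻ x, f x ∂(P i : Measure F) ≤ a i) :
    ∫⁻ x, f x ∂(Q : Measure F) ≤ b := by
  have trunc : ∀ M : ℕ, ∫⁻ x, (min (f x) M : ℝ≥0) ∂(Q : Measure F) ≤ b := by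
    intro M
    let g : BoundedContinuousFunction F ℝ≥0 :=
      BoundedContinuousFunction.mkOfBound ⟨fun x => min (f x) M, by fun_prop⟩ M (by
        intro x y
        rw [NNReal.dist_eq, abs_le]
        have h1 : ((min (f x) M : ℝ≥0) : ℝ) ≤ M := by exact_mod_cast min_le_right _ _
        have h2 : ((min (f y) M : ℝ≥0) : ℝ) ≤ M := by exact_mod_cast min_le_right _ _
        have h3 := (min (f x) (M : ℝ≥0)).coe_nonneg
        have h4 := (min (f y) (M : ℝ≥0)).coe_nonneg
        constructor <;> simp only [ContinuousMap.coe_mk] <;> linarith)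
    refine le_of_tendsto_of_tendsto
      (ProbabilityMeasure.tendsto_iff_forall_lintegral_tendsto.1 hP g) ha ?_
    filter_upwards [h] with i hi
    refine le_trans (lintegral_mono fun x => ?_) hi
    exact ENNReal.coe_le_coe.2 (min_le_left (f x) (M : ℝ≥0))
  have : ∫⁻ x, f x ∂(Q : Measure F)
      = ⨆ M : ℕ, ∫⁻ x, (min (f x) M : ℝ≥0) ∂(Q : Measure F) := by
    rw [← lintegral_iSup]
    · refine lintegral_congr fun x => le_antisymm ?_ (iSup_le fun M => ?_)
      · obtain ⟨M, hM⟩ := exists_nat_ge (f x)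
        refine le_iSup_of_le M ?_
        rw [min_eq_left hM]
      · exact_mod_cast (min_le_left (f x) (M : ℝ≥0))
    · intro M
      exact (by fun_prop : Continuous fun x => min (f x) (M : ℝ≥0)).measurable.coe_nnreal_ennreal
    · intro M N hMN x
      simp only [ENNReal.coe_le_coe]
      gcongr
  rw [this]
  exact iSup_le trunc

theorem enorm_rpow_eq_coe {F : Type*} [NormedAddCommGroup F] {p : ℝ} (hp : 0 < p) (x : F) :
    ‖x‖ₑ ^ p = ((‖x‖₊ ^ p : ℝ≥0) : ℝ≥0∞) := by
  rw [enorm_eq_nnnorm, ENNReal.coe_rpow_of_nonneg _ hp.le]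

variable [NormedAddCommGroup F] [BorelSpace F] [ProperSpace F]

/-- By Markov's inequality the mass outside the ball of radius `r` is at most `R / r^p`; closed
balls are compact since the space is proper. -/
theorem isTightMeasureSet_moment_le {p : ℝ} (hp : 0 < p) {R : ℝ≥0∞} (hR : R ≠ ∞) :
    IsTightMeasureSet {μ : Measure F | ∫⁻ x, ‖x‖ₑ ^ p ∂μ ≤ R} := by
  refine isTightMeasureSet_of_tendsto_measure_norm_gt ?_
  have hlim : Tendsto (fun r : ℝ => R / (ENNReal.ofReal r) ^ p) atTop (𝓝 0) := by
    have h1 : Tendsto (fun r : ℝ => ENNReal.ofReal r ^ p) atTop (𝓝 ∞) :=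
      (ENNReal.tendsto_rpow_at_top hp).comp ENNReal.tendsto_ofReal_atTop
    have := ENNReal.Tendsto.const_div h1 (Or.inr hR) (a := R)
    simpa using this
  refine tendsto_of_tendsto_of_tendsto_of_le_of_le' tendsto_const_nhds hlim
    (Eventually.of_forall fun _ => zero_le) ?_
  filter_upwards [eventually_gt_atTop 0] with r hr
  refine iSup₂_le fun μ hμ => ?_
  have hpos : ENNReal.ofReal r ^ p ≠ 0 := by
    simp [ENNReal.rpow_eq_zero_iff, hr, hp.not_gt]
  have htop : ENNReal.ofReal r ^ p ≠ ∞ :=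
    ENNReal.rpow_ne_top_of_nonneg hp.le ENNReal.ofReal_ne_top
  calc μ {x | r < ‖x‖} ≤ μ {x | ENNReal.ofReal r ^ p ≤ ‖x‖ₑ ^ p} := by
        refine measure_mono fun x hx => ?_
        simp only [mem_ofPred_eq] at hx ⊢
        gcongr
        rw [← ofReal_norm]
        exact ENNReal.ofReal_le_ofReal hx.le
    _ ≤ (∫⁻ x, ‖x‖ₑ ^ p ∂μ) / ENNReal.ofReal r ^ p :=
        meas_ge_le_lintegral_div (by fun_prop) hpos htop
    _ ≤ R / ENNReal.ofReal r ^ p := by gcongr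

/-- Prokhorov's theorem, with closedness from lower semicontinuity of the moment. -/
theorem isCompact_moment_le {p : ℝ} (hp : 0 < p) {R : ℝ≥0∞} (hR : R ≠ ∞) :
    IsCompact {P : ProbabilityMeasure F | ∫⁻ x, ‖x‖ₑ ^ p ∂(P : Measure F) ≤ R} := by
  set S := {P : ProbabilityMeasure F | ∫⁻ x, ‖x‖ₑ ^ p ∂(P : Measure F) ≤ R}
  have hclosed : IsClosed S := by
    refine isClosed_iff_forall_filter.2 fun P l hl hlS hlP => ?_
    have key := ProbabilityMeasure.lintegral_le_of_tendsto (l := l) (P := id) (Q := P)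
      (hP := hlP) (f := fun x : F => ‖x‖₊ ^ p)
      ((NNReal.continuous_rpow_const hp.le).comp continuous_nnnorm)
      (a := fun _ => R) (b := R) tendsto_const_nhds ?_
    · simpa only [S, mem_ofPred_eq, enorm_rpow_eq_coe hp] using key
    · filter_upwards [le_principal_iff.1 hlS] with Q hQ
      simpa only [S, mem_ofPred_eq, enorm_rpow_eq_coe hp, id_eq] using hQ
  rw [← hclosed.closure_eq]
  refine isCompact_closure_of_isTightMeasureSet ((isTightMeasureSet_moment_le hp hR).subset ?_)
  rintro _ ⟨P, hP, rfl⟩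
  exact hP

end NarrowCompactness

/-! ### The Wasserstein metric and its relation to the narrow topology -/

namespace WassersteinSpace

variable {d : ℕ} {p : ℝ}

instance (μ : WassersteinSpace d p) : IsProbabilityMeasure μ.toMeasure :=
  inferInstanceAs (IsProbabilityMeasure (μ.1 : Measure (EuclideanSpace ℝ (Fin d))))

/-- The `p`-th moment. -/
noncomputable def moment (μ : WassersteinSpace d p) : ℝ≥0∞ := ∫⁻ x, ‖x‖ₑ ^ p ∂μ.toMeasure

theorem moment_lt_top (μ : WassersteinSpace d p) : μ.moment < ∞ := μ.2

theorem ext_toMeasure {μ ν : WassersteinSpace d p} (h : μ.toMeasure = ν.toMeasure) : μ = ν :=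
  Subtype.ext (Subtype.ext h)

/-- The transport cost of a plan. -/
noncomputable def cost (p : ℝ)
    (π : Measure (EuclideanSpace ℝ (Fin d) × EuclideanSpace ℝ (Fin d))) : ℝ≥0∞ :=
  ∫⁻ z, ‖z.1 - z.2‖ₑ ^ p ∂π

theorem isProbabilityMeasure_of_mem_couplings {μ ν : WassersteinSpace d p}
    {π : Measure (EuclideanSpace ℝ (Fin d) × EuclideanSpace ℝ (Fin d))} (h : π ∈ couplings μ ν) :
    IsProbabilityMeasure π := by
  constructor
  rw [← preimage_univ (f := Prod.fst), ← Measure.map_apply measurable_fst MeasurableSet.univ, h.1]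
  exact measure_univ

theorem lintegral_fst_of_mem_couplings {μ ν : WassersteinSpace d p}
    {π : Measure (EuclideanSpace ℝ (Fin d) × EuclideanSpace ℝ (Fin d))} (h : π ∈ couplings μ ν) :
    ∫⁻ z, ‖z.1‖ₑ ^ p ∂π = μ.moment := by
  rw [moment, ← h.1, lintegral_map (by fun_prop) measurable_fst]

theorem lintegral_snd_of_mem_couplings {μ ν : WassersteinSpace d p}
    {π : Measure (EuclideanSpace ℝ (Fin d) × EuclideanSpace ℝ (Fin d))} (h : π ∈ couplings μ ν) :
    ∫⁻ z, ‖z.2‖ₑ ^ p ∂π = ν.moment := by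
  rw [moment, ← h.2, lintegral_map (by fun_prop) measurable_snd]

theorem exists_mem_couplings (μ ν : WassersteinSpace d p) : ∃ π, π ∈ couplings μ ν :=
  ⟨μ.toMeasure.prod ν.toMeasure, by simp [couplings]⟩

theorem cost_le (hp : 1 ≤ p) {μ ν : WassersteinSpace d p}
    {π : Measure (EuclideanSpace ℝ (Fin d) × EuclideanSpace ℝ (Fin d))} (h : π ∈ couplings μ ν) :
    cost p π ≤ 2 ^ (p - 1) * (μ.moment + ν.moment) := by
  rw [← lintegral_fst_of_mem_couplings h, ← lintegral_snd_of_mem_couplings h,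
    ← lintegral_add_left (by fun_prop), ← lintegral_const_mul _ (by fun_prop)]
  refine lintegral_mono fun z => ?_
  calc ‖z.1 - z.2‖ₑ ^ p ≤ (‖z.1‖ₑ + ‖z.2‖ₑ) ^ p := by gcongr; exact enorm_sub_le
    _ ≤ _ := ENNReal.rpow_add_le_mul_rpow_add_rpow _ _ hp

theorem moment_le (hp : 1 ≤ p) {μ ν : WassersteinSpace d p}
    {π : Measure (EuclideanSpace ℝ (Fin d) × EuclideanSpace ℝ (Fin d))} (h : π ∈ couplings μ ν) :
    μ.moment ≤ 2 ^ (p - 1) * (cost p π + ν.moment) := by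
  rw [← lintegral_fst_of_mem_couplings h, ← lintegral_snd_of_mem_couplings h, cost,
    ← lintegral_add_left (by fun_prop), ← lintegral_const_mul _ (by fun_prop)]
  refine lintegral_mono fun z => ?_
  calc ‖z.1‖ₑ ^ p = ‖(z.1 - z.2) + z.2‖ₑ ^ p := by rw [sub_add_cancel]
    _ ≤ (‖z.1 - z.2‖ₑ + ‖z.2‖ₑ) ^ p := by gcongr; exact enorm_add_le _ _
    _ ≤ _ := ENNReal.rpow_add_le_mul_rpow_add_rpow _ _ hp

theorem dist_nonneg (μ ν : WassersteinSpace d p) : 0 ≤ dist μ ν := ENNReal.toReal_nonneg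

theorem dist_le_of_cost_le (hp : 1 ≤ p) {μ ν : WassersteinSpace d p}
    {π : Measure (EuclideanSpace ℝ (Fin d) × EuclideanSpace ℝ (Fin d))} (h : π ∈ couplings μ ν)
    {c : ℝ} (hc : 0 ≤ c) (hπ : cost p π ≤ ENNReal.ofReal (c ^ p)) : dist μ ν ≤ c := by
  have hp0 : 0 < p := by linarith
  refine ENNReal.toReal_le_of_le_ofReal hc (iInf₂_le_of_le π h ?_)
  calc (cost p π) ^ (1 / p) ≤ ENNReal.ofReal (c ^ p) ^ (1 / p) := by gcongr
    _ = ENNReal.ofReal c := by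
      rw [ENNReal.ofReal_rpow_of_nonneg (by positivity) (by positivity), ← Real.rpow_mul hc,
        mul_one_div_cancel hp0.ne', Real.rpow_one]

theorem exists_cost_le_of_dist_lt (hp : 1 ≤ p) {μ ν : WassersteinSpace d p} {c : ℝ}
    (hc : dist μ ν < c) : ∃ π ∈ couplings μ ν, cost p π ≤ ENNReal.ofReal (c ^ p) := by
  have hp0 : 0 < p := by linarith
  have hc0 : 0 ≤ c := (dist_nonneg μ ν).trans hc.le
  have hfin : (⨅ π ∈ couplings μ ν, (cost p π) ^ (1 / p)) ≠ ∞ := by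
    obtain ⟨π, hπ⟩ := exists_mem_couplings μ ν
    refine ne_top_of_le_ne_top ?_ (iInf₂_le π hπ)
    refine ENNReal.rpow_ne_top_of_nonneg (by positivity) (ne_top_of_le_ne_top ?_ (cost_le hp hπ))
    exact ENNReal.mul_ne_top (by simp)
      (ENNReal.add_ne_top.2 ⟨μ.moment_lt_top.ne, ν.moment_lt_top.ne⟩)
  have hlt : (⨅ π ∈ couplings μ ν, (cost p π) ^ (1 / p)) < ENNReal.ofReal c :=
    (ENNReal.lt_ofReal_iff_toReal_lt hfin).2 hc
  simp only [iInf_lt_iff] at hlt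
  obtain ⟨π, hπ, h⟩ := hlt
  refine ⟨π, hπ, ?_⟩
  rw [← ENNReal.ofReal_rpow_of_nonneg hc0 hp0.le]
  calc cost p π = ((cost p π) ^ (1 / p)) ^ p := by
        rw [← ENNReal.rpow_mul, one_div_mul_cancel hp0.ne', ENNReal.rpow_one]
    _ ≤ _ := by gcongr

/-- Limits of transport plans along an ultrafilter. -/
theorem exists_limit_coupling (hp : 1 ≤ p) {ι : Type*} (U : Ultrafilter ι)
    {μs νs : ι → WassersteinSpace d p} {μ ν : WassersteinSpace d p}
    (hμ : Tendsto (fun i => (μs i).1) U (𝓝 μ.1)) (hν : Tendsto (fun i => (νs i).1) U (𝓝 ν.1))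
    {R : ℝ≥0∞} (hR : R ≠ ∞) (hμR : ∀ i, (μs i).moment ≤ R) (hνR : ∀ i, (νs i).moment ≤ R)
    {c : ι → ℝ} {c₀ : ℝ} (hc : Tendsto c U (𝓝 c₀))
    (h : ∀ i, ∃ π ∈ couplings (μs i) (νs i), cost p π ≤ ENNReal.ofReal (c i ^ p)) :
    ∃ π ∈ couplings μ ν, cost p π ≤ ENNReal.ofReal (c₀ ^ p) := by
  have hp0 : 0 < p := by linarith
  choose π hπ hcost using h
  have hprob := fun i => isProbabilityMeasure_of_mem_couplings (hπ i)
  let P : ι → ProbabilityMeasure (EuclideanSpace ℝ (Fin d) × EuclideanSpace ℝ (Fin d)) :=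
    fun i => ⟨π i, hprob i⟩
  -- The product carries the maximum norm, so the moment of a plan is at most the sum of the moments
  -- of its marginals.
  have hmem : ∀ i, P i ∈ {P : ProbabilityMeasure
      (EuclideanSpace ℝ (Fin d) × EuclideanSpace ℝ (Fin d)) |
      ∫⁻ z, ‖z‖ₑ ^ p ∂(P : Measure (EuclideanSpace ℝ (Fin d) × EuclideanSpace ℝ (Fin d)))
        ≤ R + R} := by
    intro i
    calc ∫⁻ z, ‖z‖ₑ ^ p ∂(π i) ≤ ∫⁻ z, (‖z.1‖ₑ ^ p + ‖z.2‖ₑ ^ p) ∂(π i) := by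
          refine lintegral_mono fun z => ?_
          rw [← ofReal_norm, Prod.norm_def]
          rcases max_choice ‖z.1‖ ‖z.2‖ with h | h <;> rw [h, ofReal_norm]
          · exact le_self_add
          · exact le_add_self
      _ = (μs i).moment + (νs i).moment := by
          rw [lintegral_add_left (by fun_prop), lintegral_fst_of_mem_couplings (hπ i),
            lintegral_snd_of_mem_couplings (hπ i)]
      _ ≤ R + R := add_le_add (hμR i) (hνR i)
  obtain ⟨Q, -, hQ⟩ := (isCompact_moment_le (F := EuclideanSpace ℝ (Fin d) ×
    EuclideanSpace ℝ (Fin d)) hp0 (ENNReal.add_ne_top.2 ⟨hR, hR⟩)).ultrafilter_le_nhds' (U.map P)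
    (Filter.mem_map.2 (Filter.Eventually.of_forall hmem))
  have hQ' : Tendsto P U (𝓝 Q) := hQ
  refine ⟨Q, ⟨?_, ?_⟩, ?_⟩
  · have h1 := ProbabilityMeasure.tendsto_map_of_tendsto_of_continuous P Q hQ'
      (continuous_fst (X := EuclideanSpace ℝ (Fin d)) (Y := EuclideanSpace ℝ (Fin d)))
    have h2 : (fun i => (P i).map (continuous_fst.measurable.aemeasurable (μ := (P i : Measure
      (EuclideanSpace ℝ (Fin d) × EuclideanSpace ℝ (Fin d)))))) = fun i => (μs i).1 := by
      funext i
      exact Subtype.ext (hπ i).1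
    rw [h2] at h1
    have h3 := tendsto_nhds_unique h1 hμ
    exact congrArg (fun P : ProbabilityMeasure (EuclideanSpace ℝ (Fin d)) =>
      (P : Measure (EuclideanSpace ℝ (Fin d)))) h3
  · have h1 := ProbabilityMeasure.tendsto_map_of_tendsto_of_continuous P Q hQ'
      (continuous_snd (X := EuclideanSpace ℝ (Fin d)) (Y := EuclideanSpace ℝ (Fin d)))
    have h2 : (fun i => (P i).map (continuous_snd.measurable.aemeasurable (μ := (P i : Measure
      (EuclideanSpace ℝ (Fin d) × EuclideanSpace ℝ (Fin d)))))) = fun i => (νs i).1 := by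
      funext i
      exact Subtype.ext (hπ i).2
    rw [h2] at h1
    have h3 := tendsto_nhds_unique h1 hν
    exact congrArg (fun P : ProbabilityMeasure (EuclideanSpace ℝ (Fin d)) =>
      (P : Measure (EuclideanSpace ℝ (Fin d)))) h3
  · have key := ProbabilityMeasure.lintegral_le_of_tendsto hQ'
      (f := fun z => ‖z.1 - z.2‖₊ ^ p)
      ((NNReal.continuous_rpow_const hp0.le).comp
        (continuous_nnnorm.comp (continuous_fst.sub continuous_snd)))
      (a := fun i => ENNReal.ofReal (c i ^ p)) (b := ENNReal.ofReal (c₀ ^ p))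
      (ENNReal.tendsto_ofReal (hc.rpow_const (Or.inr hp0.le)))
      (Eventually.of_forall fun i => by
        simpa only [cost, enorm_rpow_eq_coe hp0] using! hcost i)
    simpa only [cost, enorm_rpow_eq_coe hp0] using key

/-- Lower semicontinuity of the Wasserstein distance. -/
theorem dist_le_of_tendsto (hp : 1 ≤ p) {ι : Type*} (U : Ultrafilter ι)
    {μs νs : ι → WassersteinSpace d p} {μ ν : WassersteinSpace d p}
    (hμ : Tendsto (fun i => (μs i).1) U (𝓝 μ.1)) (hν : Tendsto (fun i => (νs i).1) U (𝓝 ν.1))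
    {R : ℝ≥0∞} (hR : R ≠ ∞) (hμR : ∀ i, (μs i).moment ≤ R) (hνR : ∀ i, (νs i).moment ≤ R)
    {c : ι → ℝ} {c₀ : ℝ} (hc : Tendsto c U (𝓝 c₀)) (h : ∀ i, dist (μs i) (νs i) ≤ c i) :
    dist μ ν ≤ c₀ := by
  have hc0 : 0 ≤ c₀ := ge_of_tendsto hc (Eventually.of_forall fun i =>
    (dist_nonneg _ _).trans (h i))
  -- The slack `ε` makes the bound strict, so that near-optimal plans suffice; optimal ones are
  -- obtained later from the same limit argument.
  refine le_of_forall_pos_le_add fun ε hε => ?_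
  obtain ⟨π, hπ, hcost⟩ := exists_limit_coupling hp U hμ hν hR hμR hνR (hc.add_const ε)
    (fun i => exists_cost_le_of_dist_lt hp (lt_of_le_of_lt (h i) (lt_add_of_pos_right _ hε)))
  exact dist_le_of_cost_le hp hπ (by positivity) hcost

/-- Optimal transport plans exist. -/
theorem exists_optimal_coupling (hp : 1 ≤ p) (μ ν : WassersteinSpace d p) :
    ∃ π ∈ couplings μ ν, cost p π ≤ ENNReal.ofReal (dist μ ν ^ p) := by
  have hc : Tendsto (fun n : ℕ => dist μ ν + 1 / ((n : ℝ) + 1)) (hyperfilter ℕ)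
      (𝓝 (dist μ ν)) := by
    have := (tendsto_one_div_add_atTop_nhds_zero_nat (𝕜 := ℝ)).const_add (dist μ ν)
    rw [add_zero] at this
    exact this.mono_left Nat.hyperfilter_le_atTop
  refine exists_limit_coupling hp (hyperfilter ℕ) (μs := fun _ => μ) (νs := fun _ => ν)
    tendsto_const_nhds tendsto_const_nhds (R := μ.moment + ν.moment)
    (ENNReal.add_ne_top.2 ⟨μ.moment_lt_top.ne, ν.moment_lt_top.ne⟩)
    (fun _ => le_self_add) (fun _ => le_add_self) hc (fun n => ?_)
  exact exists_cost_le_of_dist_lt hp (lt_add_of_pos_right _ (by positivity))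

theorem dist_self (hp : 1 ≤ p) (μ : WassersteinSpace d p) : dist μ μ = 0 := by
  have hp0 : 0 < p := by linarith
  refine le_antisymm ?_ (dist_nonneg _ _)
  have hm : Measurable fun x : EuclideanSpace ℝ (Fin d) => (x, x) := by fun_prop
  refine dist_le_of_cost_le hp (π := μ.toMeasure.map fun x => (x, x)) ⟨?_, ?_⟩ le_rfl ?_
  · rw [Measure.map_map measurable_fst hm]
    exact Measure.map_id
  · rw [Measure.map_map measurable_snd hm]
    exact Measure.map_id
  · rw [cost, lintegral_map (by fun_prop) hm]
    simp [hp0]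

theorem dist_comm_le (hp : 1 ≤ p) (μ ν : WassersteinSpace d p) : dist μ ν ≤ dist ν μ := by
  obtain ⟨π, hπ, hcost⟩ := exists_optimal_coupling hp ν μ
  refine dist_le_of_cost_le hp (π := π.map Prod.swap) ⟨?_, ?_⟩ (dist_nonneg _ _) ?_
  · rw [Measure.map_map measurable_fst measurable_swap]
    exact hπ.2
  · rw [Measure.map_map measurable_snd measurable_swap]
    exact hπ.1
  · rw [cost, lintegral_map (by fun_prop) measurable_swap]
    simpa only [Prod.fst_swap, Prod.snd_swap, enorm_sub_rev, cost] using hcost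

theorem dist_comm (hp : 1 ≤ p) (μ ν : WassersteinSpace d p) : dist μ ν = dist ν μ :=
  le_antisymm (dist_comm_le hp μ ν) (dist_comm_le hp ν μ)

/-- An optimal plan of zero cost is concentrated on the diagonal, so its two projections agree
almost everywhere. -/
theorem eq_of_dist_eq_zero (hp : 1 ≤ p) {μ ν : WassersteinSpace d p} (h : dist μ ν = 0) :
    μ = ν := by
  have hp0 : 0 < p := by linarith
  obtain ⟨π, hπ, hcost⟩ := exists_optimal_coupling hp μ ν
  rw [h, Real.zero_rpow hp0.ne', ENNReal.ofReal_zero, nonpos_iff_eq_zero, cost,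
    lintegral_eq_zero_iff (by fun_prop)] at hcost
  refine ext_toMeasure ?_
  rw [← hπ.1, ← hπ.2]
  refine Measure.map_congr ?_
  filter_upwards [hcost] with z hz
  simpa [hp0, hp0.not_gt, sub_eq_zero] using hz

/-- The triangle inequality, by gluing optimal plans. -/
theorem dist_triangle (hp : 1 ≤ p) (μ ν ρ : WassersteinSpace d p) :
    dist μ ρ ≤ dist μ ν + dist ν ρ := by
  have hp0 : 0 < p := by linarith
  obtain ⟨π₁, hπ₁, hc₁⟩ := exists_optimal_coupling hp μ ν
  obtain ⟨π₂, hπ₂, hc₂⟩ := exists_optimal_coupling hp ν ρ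
  have := isProbabilityMeasure_of_mem_couplings hπ₁
  have := isProbabilityMeasure_of_mem_couplings hπ₂
  -- The kernel disintegrates `π₂` over the shared marginal `ν` and sees only the middle point;
  -- hence `γ` projects to both `π₁` and `π₂`.
  let κ : Kernel (EuclideanSpace ℝ (Fin d) × EuclideanSpace ℝ (Fin d))
      (EuclideanSpace ℝ (Fin d)) := π₂.condKernel.comap Prod.snd measurable_snd
  let γ := π₁ ⊗ₘ κ
  have hγ₁ : γ.map Prod.fst = π₁ := Measure.fst_compProd π₁ κ
  have hγ₂ : γ.map (fun z => (z.1.2, z.2)) = π₂ := by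
    conv_rhs => rw [← π₂.disintegrate π₂.condKernel]
    have hfst : π₂.fst = π₁.map Prod.snd := by rw [hπ₁.2]; exact hπ₂.1
    rw [hfst]
    ext s hs
    have hm : Measurable fun z : (EuclideanSpace ℝ (Fin d) × EuclideanSpace ℝ (Fin d)) ×
      EuclideanSpace ℝ (Fin d) => (z.1.2, z.2) := by fun_prop
    rw [Measure.map_apply hm hs, Measure.compProd_apply (hm hs), Measure.compProd_apply hs,
      lintegral_map (Kernel.measurable_kernel_prodMk_left hs) measurable_snd]
    rfl
  have hfst : Measurable fun z : (EuclideanSpace ℝ (Fin d) × EuclideanSpace ℝ (Fin d)) ×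
      EuclideanSpace ℝ (Fin d) => (z.1.1, z.2) := by fun_prop
  refine dist_le_of_cost_le hp (π := γ.map fun z => (z.1.1, z.2)) ⟨?_, ?_⟩
    (add_nonneg (dist_nonneg _ _) (dist_nonneg _ _)) ?_
  · rw [Measure.map_map measurable_fst hfst, ← hπ₁.1, ← hγ₁, Measure.map_map measurable_fst
      measurable_fst]
    rfl
  · rw [Measure.map_map measurable_snd hfst, ← hπ₂.2, ← hγ₂, Measure.map_map measurable_snd
      (by fun_prop)]
    rfl
  · have e₁ : cost p π₁ = ∫⁻ z, ‖z.1.1 - z.1.2‖ₑ ^ p ∂γ := by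
      rw [← hγ₁, cost, lintegral_map (by fun_prop) measurable_fst]
    have e₂ : cost p π₂ = ∫⁻ z, ‖z.1.2 - z.2‖ₑ ^ p ∂γ := by
      rw [← hγ₂, cost, lintegral_map (by fun_prop) (by fun_prop)]
    have root : ∀ {a : ℝ≥0∞} {c : ℝ}, 0 ≤ c → a ≤ ENNReal.ofReal (c ^ p) →
        a ^ (1 / p) ≤ ENNReal.ofReal c := by
      intro a c hc ha
      rw [← ENNReal.ofReal_rpow_of_nonneg hc hp0.le] at ha
      exact (ENNReal.rpow_inv_le_iff hp0).2 ha |> (by rw [one_div]; exact ·)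
    have mink := ENNReal.lintegral_Lp_add_le (μ := γ) (p := p)
      (f := fun z => ‖z.1.1 - z.1.2‖ₑ) (g := fun z => ‖z.1.2 - z.2‖ₑ)
      (by fun_prop) (by fun_prop) hp
    rw [← e₁, ← e₂] at mink
    have mink' := mink.trans (add_le_add (root (dist_nonneg _ _) hc₁) (root (dist_nonneg _ _) hc₂))
    rw [← ENNReal.ofReal_add (dist_nonneg _ _) (dist_nonneg _ _)] at mink'
    rw [cost, lintegral_map (by fun_prop) hfst, ← ENNReal.ofReal_rpow_of_nonneg
      (add_nonneg (dist_nonneg _ _) (dist_nonneg _ _)) hp0.le]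
    refine le_trans ?_ ((ENNReal.rpow_inv_le_iff hp0).1 (by rw [← one_div]; exact mink'))
    refine lintegral_mono fun z => ?_
    simp only [Pi.add_apply]
    gcongr
    calc ‖z.1.1 - z.2‖ₑ = ‖(z.1.1 - z.1.2) + (z.1.2 - z.2)‖ₑ := by rw [sub_add_sub_cancel]
      _ ≤ _ := enorm_add_le _ _

/-- The Wasserstein distance as a pseudometric structure. -/
@[reducible] noncomputable def pseudoMetricSpace (hp : 1 ≤ p) :
    PseudoMetricSpace (WassersteinSpace d p) where
  dist := dist
  dist_self := dist_self hp
  dist_comm := dist_comm hp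
  dist_triangle := dist_triangle hp

theorem moment_le_of_dist_le (hp : 1 ≤ p) (ν : WassersteinSpace d p) (r : ℝ) :
    ∃ R : ℝ≥0∞, R ≠ ∞ ∧ ∀ μ : WassersteinSpace d p, dist μ ν ≤ r → μ.moment ≤ R := by
  refine ⟨2 ^ (p - 1) * (ENNReal.ofReal (r ^ p) + ν.moment), ENNReal.mul_ne_top (by simp)
    (ENNReal.add_ne_top.2 ⟨ENNReal.ofReal_ne_top, ν.moment_lt_top.ne⟩), fun μ h => ?_⟩
  obtain ⟨π, hπ, hc⟩ := exists_optimal_coupling hp μ ν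
  refine (moment_le hp hπ).trans ?_
  gcongr
  refine hc.trans (ENNReal.ofReal_le_ofReal ?_)
  exact Real.rpow_le_rpow (dist_nonneg _ _) h (by linarith)

/-- Moment-bounded families have limits along ultrafilters. -/
theorem exists_tendsto_of_moment_le (hp : 1 ≤ p) {ι : Type*} (U : Ultrafilter ι)
    {μs : ι → WassersteinSpace d p} {R : ℝ≥0∞} (hR : R ≠ ∞) (hμR : ∀ i, (μs i).moment ≤ R) :
    ∃ μ : WassersteinSpace d p, Tendsto (fun i => (μs i).1) U (𝓝 μ.1) := by
  obtain ⟨Q, hQ, hQ'⟩ := (isCompact_moment_le (F := EuclideanSpace ℝ (Fin d)) (p := p)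
    (by linarith) hR).ultrafilter_le_nhds' (U.map fun i => (μs i).1)
    (Filter.mem_map.2 (Filter.Eventually.of_forall hμR))
  exact ⟨⟨Q, hQ.trans_lt hR.lt_top⟩, hQ'⟩

theorem NarrowlyContinuous.tendsto {F : WassersteinSpace d p → ℝ} (hF : NarrowlyContinuous F)
    {ι : Type*} {l : Filter ι} {μs : ι → WassersteinSpace d p} {μ : WassersteinSpace d p}
    (h : Tendsto (fun i => (μs i).1) l (𝓝 μ.1)) : Tendsto (fun i => F (μs i)) l (𝓝 (F μ)) := by
  let : TopologicalSpace (WassersteinSpace d p) := TopologicalSpace.induced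
      (fun μ : WassersteinSpace d p =>
        (μ.1 : ProbabilityMeasure (EuclideanSpace ℝ (Fin d)))) inferInstance
  refine (Continuous.tendsto hF μ).comp ?_
  rw [nhds_induced]
  exact tendsto_comap_iff.2 h

/-- Narrowly continuous functionals are uniformly continuous for the Wasserstein distance on sets
of bounded moment. -/
theorem NarrowlyContinuous.uniformly (hp : 1 ≤ p) {F : WassersteinSpace d p → ℝ}
    (hF : NarrowlyContinuous F) {R : ℝ≥0∞} (hR : R ≠ ∞) {ε : ℝ} (hε : 0 < ε) :
    ∃ δ > 0, ∀ μ ν : WassersteinSpace d p, μ.moment ≤ R → ν.moment ≤ R → dist μ ν < δ →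
      |F μ - F ν| < ε := by
  by_contra! hcon
  choose μ ν hμ hν hd hF' using fun n : ℕ => hcon (1 / ((n : ℝ) + 1)) (by positivity)
  -- Counterexample sequences have narrow limits at distance zero. These coincide, so the values of
  -- `F` cannot stay `ε` apart.
  let U := hyperfilter ℕ
  obtain ⟨μ₀, hμ₀⟩ := exists_tendsto_of_moment_le hp U hR hμ
  obtain ⟨ν₀, hν₀⟩ := exists_tendsto_of_moment_le hp U hR hν
  have hc : Tendsto (fun n : ℕ => 1 / ((n : ℝ) + 1)) U (𝓝 0) :=
    (tendsto_one_div_add_atTop_nhds_zero_nat (𝕜 := ℝ)).mono_left Nat.hyperfilter_le_atTop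
  have h0 := dist_le_of_tendsto hp U hμ₀ hν₀ hR hμ hν hc (fun n => (hd n).le)
  have heq := eq_of_dist_eq_zero hp (le_antisymm h0 (dist_nonneg _ _))
  have hlim := ((hF.tendsto hμ₀).sub (hF.tendsto hν₀)).abs
  rw [heq, sub_self, abs_zero] at hlim
  have := ge_of_tendsto hlim (Eventually.of_forall hF')
  linarith

end WassersteinSpace

/-! ### Minimal speed of curves in a pseudometric space -/

section SpeedBounds

/-- Bernoulli's inequality at `x / M - 1`. With `M` left free, this convexity bound replaces Hölder
and Jensen throughout and, being affine in `x`, survives limits. -/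
theorem Real.rpow_tangent_le {p : ℝ} (hp : 1 < p) {x M : ℝ} (hx : 0 ≤ x) (hM : 0 ≤ M) :
    M ^ p + p * M ^ (p - 1) * (x - M) ≤ x ^ p := by
  rcases hM.eq_or_lt with rfl | hM
  · rw [Real.zero_rpow (by linarith), Real.zero_rpow (by linarith)]
    simpa using Real.rpow_nonneg hx p
  · have h := one_add_mul_self_le_rpow_one_add (s := x / M - 1)
      (by linarith [div_nonneg hx hM.le]) hp.le
    rw [add_sub_cancel, Real.div_rpow hx hM.le, le_div_iff₀ (by positivity)] at h
    refine le_trans (le_of_eq ?_) h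
    rw [Real.rpow_sub_one hM.ne']
    field_simp

/-- The primitive of `g - f` is monotone, and Lebesgue differentiation recovers the integrand almost
everywhere. -/
theorem ae_le_of_forall_intervalIntegral_le {t : ℝ} {f g : ℝ → ℝ}
    (hf : IntervalIntegrable f volume 0 t) (hg : IntervalIntegrable g volume 0 t)
    (h : ∀ a b, 0 ≤ a → a ≤ b → b ≤ t → ∫ s in a..b, f s ≤ ∫ s in a..b, g s) :
    f ≤ᵐ[volume.restrict (Icc 0 t)] g := by
  rcases lt_or_ge t 0 with ht | ht
  · rw [Icc_eq_empty ht.not_ge, Measure.restrict_empty, ae_zero]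
    exact eventually_bot
  have hi := hg.sub hf
  have hmono : MonotoneOn (fun x => ∫ s in (0 : ℝ)..x, (g s - f s)) (Icc 0 t) := by
    intro a ha b hb hab
    have sub : ∀ x ∈ Icc 0 t, uIcc 0 x ⊆ uIcc 0 t := fun x hx => by
      rw [uIcc_of_le hx.1, uIcc_of_le ht]
      exact Icc_subset_Icc_right hx.2
    have hsub : uIcc a b ⊆ uIcc 0 t := by
      rw [uIcc_of_le hab, uIcc_of_le ht]
      exact Icc_subset_Icc ha.1 hb.2
    have hdiff := intervalIntegral.integral_interval_sub_left (hi.mono_set (sub b hb))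
      (hi.mono_set (sub a ha))
    rw [intervalIntegral.integral_sub (hg.mono_set hsub) (hf.mono_set hsub)] at hdiff
    have := h a b ha.1 hab hb.2
    simp only
    linarith
  rw [EventuallyLE, ← restrict_Ioo_eq_restrict_Icc, ae_restrict_iff' measurableSet_Ioo]
  filter_upwards [hi.ae_hasDerivAt_integral] with x hx hxt
  have hd := hx (by rw [uIcc_of_le ht]; exact Ioo_subset_Icc_self hxt) 0 (by simp)
  have := hd.hasDerivWithinAt.nonneg_of_monotoneOn (s := Ioo 0 t)
    (uniqueDiffWithinAt_iff_accPt.1 (isOpen_Ioo.uniqueDiffWithinAt hxt)) (hmono.mono Ioo_subset_Icc_self)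
  linarith

theorem AbsolutelyContinuousOnInterval.of_dist_le {X Y : Type*} [PseudoMetricSpace X]
    [PseudoMetricSpace Y] {f : ℝ → X} {g : ℝ → Y} {a b : ℝ}
    (hg : AbsolutelyContinuousOnInterval g a b)
    (h : ∀ x ∈ uIcc a b, ∀ y ∈ uIcc a b, dist (f x) (f y) ≤ dist (g x) (g y)) :
    AbsolutelyContinuousOnInterval f a b := by
  rw [absolutelyContinuousOnInterval_iff] at hg ⊢
  intro ε hε
  obtain ⟨δ, hδ, H⟩ := hg ε hε
  refine ⟨δ, hδ, fun E hE hEδ => lt_of_le_of_lt (Finset.sum_le_sum fun i hi => ?_) (H E hE hEδ)⟩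
  exact h _ (hE.1 i hi).1 _ (hE.1 i hi).2

theorem IntervalIntegrable.mono_of_le {f : ℝ → ℝ} {a b t : ℝ}
    (hf : IntervalIntegrable f volume 0 t) (ha : 0 ≤ a) (hab : a ≤ b) (hb : b ≤ t) :
    IntervalIntegrable f volume a b := by
  refine hf.mono_set ?_
  rw [uIcc_of_le hab, uIcc_of_le (ha.trans (hab.trans hb))]
  exact Icc_subset_Icc ha hb

theorem intervalIntegral_sub_of_le {f : ℝ → ℝ} {a b t : ℝ}
    (hf : IntervalIntegrable f volume 0 t) (ha : 0 ≤ a) (hab : a ≤ b) (hb : b ≤ t) :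
    (∫ s in (0 : ℝ)..b, f s) - ∫ s in (0 : ℝ)..a, f s = ∫ s in a..b, f s :=
  intervalIntegral.integral_interval_sub_left
    (hf.mono_of_le le_rfl (ha.trans hab) hb) (hf.mono_of_le le_rfl ha (hab.trans hb))

variable {X : Type*} [PseudoMetricSpace X]

/-- Over a partition the integrals of `g` add up; the two end pieces missed by it are nonnegative
because they dominate distances. -/
theorem eVariationOn_le_of_dist_le_integral {t : ℝ} {σ : ℝ → X} {g : ℝ → ℝ}
    (hg : IntervalIntegrable g volume 0 t)
    (h : ∀ s₁ s₂, 0 ≤ s₁ → s₁ ≤ s₂ → s₂ ≤ t → dist (σ s₁) (σ s₂) ≤ ∫ u in s₁..s₂, g u)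
    {a b : ℝ} (ha : 0 ≤ a) (hb : b ≤ t) :
    eVariationOn σ (Icc a b) ≤ ENNReal.ofReal (∫ s in a..b, g s) := by
  refine iSup_le ?_
  rintro ⟨n, u, hu, hus⟩
  have nn : ∀ x y, 0 ≤ x → x ≤ y → y ≤ t → 0 ≤ ∫ s in x..y, g s := fun x y hx hxy hy =>
    _root_.dist_nonneg.trans (h x y hx hxy hy)
  have hu0 : ∀ i, 0 ≤ u i := fun i => ha.trans (hus i).1
  have hut : ∀ i, u i ≤ t := fun i => (hus i).2.trans hb
  have hab : a ≤ b := (hus 0).1.trans (hus 0).2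
  calc ∑ i ∈ Finset.range n, edist (σ (u (i + 1))) (σ (u i))
      ≤ ∑ i ∈ Finset.range n, ENNReal.ofReal (∫ s in (u i)..(u (i + 1)), g s) := by
        refine Finset.sum_le_sum fun i _ => ?_
        rw [edist_comm, edist_dist]
        exact ENNReal.ofReal_le_ofReal (h _ _ (hu0 i) (hu (Nat.le_succ i)) (hut _))
    _ = ENNReal.ofReal (∫ s in (u 0)..(u n), g s) := by
        rw [← ENNReal.ofReal_sum_of_nonneg fun i _ =>
          nn _ _ (hu0 i) (hu (Nat.le_succ i)) (hut _),
          intervalIntegral.sum_integral_adjacent_intervals fun i _ =>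
            hg.mono_of_le (hu0 i) (hu (Nat.le_succ i)) (hut _)]
    _ ≤ ENNReal.ofReal (∫ s in a..b, g s) := by
        refine ENNReal.ofReal_le_ofReal ?_
        have e1 := intervalIntegral_sub_of_le hg ha (hus 0).1 (hut 0)
        have e2 := intervalIntegral_sub_of_le hg (hu0 0) (hu (Nat.zero_le n)) (hut n)
        have e3 := intervalIntegral_sub_of_le hg (hu0 n) (hus n).2 hb
        have e4 := intervalIntegral_sub_of_le hg ha hab hb
        have n1 := nn a (u 0) ha (hus 0).1 (hut 0)
        have n3 := nn (u n) b (hu0 n) (hus n).2 hb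
        linarith

/-- A curve that admits an integrable speed bound has a smallest one: the derivative of its
variation. -/
theorem exists_minimal_speed {t : ℝ} (ht : 0 ≤ t) {σ : ℝ → X} {h : ℝ → ℝ}
    (hh : IntervalIntegrable h volume 0 t)
    (hσ : ∀ s₁ s₂, 0 ≤ s₁ → s₁ ≤ s₂ → s₂ ≤ t → dist (σ s₁) (σ s₂) ≤ ∫ u in s₁..s₂, h u) :
    ∃ m : ℝ → ℝ, IntervalIntegrable m volume 0 t ∧
      (∀ s₁ s₂, 0 ≤ s₁ → s₁ ≤ s₂ → s₂ ≤ t → dist (σ s₁) (σ s₂) ≤ ∫ u in s₁..s₂, m u) ∧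
      ∀ g : ℝ → ℝ, IntervalIntegrable g volume 0 t →
        (∀ s₁ s₂, 0 ≤ s₁ → s₁ ≤ s₂ → s₂ ≤ t → dist (σ s₁) (σ s₂) ≤ ∫ u in s₁..s₂, g u) →
        m ≤ᵐ[volume.restrict (Icc 0 t)] g := by
  let F : ℝ → ℝ := fun s => (eVariationOn σ (Icc 0 s)).toReal
  have fin : ∀ {a b : ℝ}, 0 ≤ a → b ≤ t → eVariationOn σ (Icc a b) ≠ ∞ := fun ha hb =>
    ne_top_of_le_ne_top ENNReal.ofReal_ne_top (eVariationOn_le_of_dist_le_integral hh hσ ha hb)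
  have hF : ∀ {a b : ℝ}, 0 ≤ a → a ≤ b → b ≤ t →
      F b - F a = (eVariationOn σ (Icc a b)).toReal := by
    intro a b ha hab hb
    have e := eVariationOn.Icc_add_Icc σ (s := univ) ha hab (mem_univ a)
    simp only [univ_inter] at e
    simp only [F]
    rw [← e, ENNReal.toReal_add (fin le_rfl (hab.trans hb)) (fin ha hb)]
    ring
  have hFle : ∀ g : ℝ → ℝ, IntervalIntegrable g volume 0 t →
      (∀ s₁ s₂, 0 ≤ s₁ → s₁ ≤ s₂ → s₂ ≤ t → dist (σ s₁) (σ s₂) ≤ ∫ u in s₁..s₂, g u) →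
      ∀ a b, 0 ≤ a → a ≤ b → b ≤ t → F b - F a ≤ ∫ s in a..b, g s := by
    intro g hg hgσ a b ha hab hb
    rw [hF ha hab hb]
    exact ENNReal.toReal_le_of_le_ofReal (_root_.dist_nonneg.trans (hgσ a b ha hab hb))
      (eVariationOn_le_of_dist_le_integral hg hgσ ha hb)
  -- The increments of the variation are dominated by those of the primitive of `h`, which is
  -- absolutely continuous.
  have hAC : AbsolutelyContinuousOnInterval F 0 t := by
    refine (hh.absolutelyContinuousOnInterval_intervalIntegral (c := 0) (by simp)).of_dist_le ?_
    rw [uIcc_of_le ht]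
    have key : ∀ x ∈ Icc 0 t, ∀ y ∈ Icc 0 t, x ≤ y → dist (F x) (F y) ≤
        dist (∫ v in (0 : ℝ)..x, h v) (∫ v in (0 : ℝ)..y, h v) := by
      intro x hx y hy hxy
      have h1 := hFle h hh hσ x y hx.1 hxy hy.2
      have h2 := hF hx.1 hxy hy.2
      rw [_root_.dist_comm, Real.dist_eq, _root_.dist_comm, Real.dist_eq,
        intervalIntegral_sub_of_le hh hx.1 hxy hy.2, abs_of_nonneg (by rw [h2]; positivity)]
      exact h1.trans (le_abs_self _)
    intro x hx y hy
    rcases le_total x y with hxy | hxy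
    · exact key x hx y hy hxy
    · rw [_root_.dist_comm, _root_.dist_comm (∫ v in (0 : ℝ)..x, h v)]
      exact key y hy x hx hxy
  have hint : ∀ a b, 0 ≤ a → a ≤ b → b ≤ t → ∫ s in a..b, deriv F s = F b - F a := by
    intro a b ha hab hb
    refine (hAC.mono ?_).integral_deriv_eq_sub
    rw [uIcc_of_le hab, uIcc_of_le ht]
    exact Icc_subset_Icc ha hb
  refine ⟨deriv F, hAC.intervalIntegrable_deriv, ?_, ?_⟩
  · intro a b ha hab hb
    rw [hint a b ha hab hb, hF ha hab hb]
    exact BoundedVariationOn.dist_le (fin ha hb) (left_mem_Icc.2 hab) (right_mem_Icc.2 hab)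
  · intro g hg hgσ
    refine ae_le_of_forall_intervalIntegral_le hAC.intervalIntegrable_deriv hg ?_
    intro a b ha hab hb
    rw [hint a b ha hab hb]
    exact hFle g hg hgσ a b ha hab hb

theorem ae_nonneg_of_dist_le_integral {t : ℝ} {σ : ℝ → X} {g : ℝ → ℝ}
    (hg : IntervalIntegrable g volume 0 t)
    (h : ∀ s₁ s₂, 0 ≤ s₁ → s₁ ≤ s₂ → s₂ ≤ t → dist (σ s₁) (σ s₂) ≤ ∫ u in s₁..s₂, g u) :
    0 ≤ᵐ[volume.restrict (Icc 0 t)] g := by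
  refine ae_le_of_forall_intervalIntegral_le (IntervalIntegrable.refl.trans ?_) hg ?_
  · exact intervalIntegrable_const
  · intro a b ha hab hb
    simpa using _root_.dist_nonneg.trans (h a b ha hab hb)

end SpeedBounds

/-! ### Limits of speeds with bounded `p`-energy -/

section LimitOfSpeeds

variable {p t : ℝ}

/-- Integrated form of the tangent line inequality. -/
theorem integral_rpow_tangent_le (hp : 1 < p) {h : ℝ → ℝ}
    (hh : IntervalIntegrable h volume 0 t)
    (hhp : IntervalIntegrable (fun s => h s ^ p) volume 0 t)
    (h0 : 0 ≤ᵐ[volume.restrict (Icc 0 t)] h) {a b : ℝ} (ha : 0 ≤ a) (hab : a ≤ b) (hb : b ≤ t)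
    {M : ℝ} (hM : 0 ≤ M) :
    M ^ p * (b - a) + p * M ^ (p - 1) * ((∫ s in a..b, h s) - M * (b - a)) ≤
      ∫ s in a..b, h s ^ p := by
  have hi := hh.mono_of_le ha hab hb
  have e : ∫ s in a..b, (M ^ p + p * M ^ (p - 1) * (h s - M)) =
      M ^ p * (b - a) + p * M ^ (p - 1) * ((∫ s in a..b, h s) - M * (b - a)) := by
    rw [intervalIntegral.integral_add intervalIntegrable_const
      ((hi.sub intervalIntegrable_const).const_mul _), intervalIntegral.integral_const_mul,
      intervalIntegral.integral_sub hi intervalIntegrable_const]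
    simp only [intervalIntegral.integral_const, smul_eq_mul]
    ring
  rw [← e]
  refine intervalIntegral.integral_mono_ae_restrict hab
    (intervalIntegrable_const.add ((hi.sub intervalIntegrable_const).const_mul _))
    (hhp.mono_of_le ha hab hb) ?_
  filter_upwards [ae_restrict_of_ae_restrict_of_subset (Icc_subset_Icc ha hb) h0] with s hs
  exact Real.rpow_tangent_le hp hs hM

theorem memLp_Icc_iff (hp : 1 < p) (ht : 0 ≤ t) {h : ℝ → ℝ}
    (hm : AEStronglyMeasurable h (volume.restrict (Icc 0 t)))
    (h0 : 0 ≤ᵐ[volume.restrict (Icc 0 t)] h) :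
    MemLp h (ENNReal.ofReal p) (volume.restrict (Icc 0 t)) ↔
      IntervalIntegrable (fun s => h s ^ p) volume 0 t := by
  rw [intervalIntegrable_iff_integrableOn_Icc_of_le ht, IntegrableOn,
    ← integrable_norm_rpow_iff hm (by simp; linarith) (by simp),
    ENNReal.toReal_ofReal (by linarith)]
  refine integrable_congr ?_
  filter_upwards [h0] with s hs
  rw [Real.norm_of_nonneg hs]

theorem MeasureTheory.MemLp.intervalIntegrable_Icc (hp : 1 < p) (ht : 0 ≤ t) {h : ℝ → ℝ}
    (hm : MemLp h (ENNReal.ofReal p) (volume.restrict (Icc 0 t))) :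
    IntervalIntegrable h volume 0 t := by
  rw [intervalIntegrable_iff_integrableOn_Icc_of_le ht]
  exact hm.integrable (by rw [← ENNReal.ofReal_one]; exact ENNReal.ofReal_le_ofReal hp.le)

/-- The integrated tangent inequality, summed over disjoint intervals, bounds the increments of the
primitives uniformly in `i`, so the bound passes to `F`. -/
theorem AbsolutelyContinuousOnInterval.of_tendsto_primitive (hp : 1 < p) (ht : 0 ≤ t) {ι : Type*}
    {l : Filter ι} [l.NeBot] {h : ι → ℝ → ℝ} (hh : ∀ i, IntervalIntegrable (h i) volume 0 t)
    (hhp : ∀ i, IntervalIntegrable (fun s => h i s ^ p) volume 0 t)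
    (h0 : ∀ i, 0 ≤ᵐ[volume.restrict (Icc 0 t)] h i) {K : ℝ}
    (hK : ∀ i, ∫ s in (0 : ℝ)..t, h i s ^ p ≤ K) {F : ℝ → ℝ}
    (hF : ∀ s ∈ Icc 0 t, Tendsto (fun i => ∫ u in (0 : ℝ)..s, h i u) l (𝓝 (F s))) :
    AbsolutelyContinuousOnInterval F 0 t := by
  have step : ∀ M > 0, ∀ E ∈ disjWithin 0 t, p * M ^ (p - 1) *
      ∑ j ∈ Finset.range E.1, dist (F (E.2 j).1) (F (E.2 j).2) ≤
      K + (p - 1) * M ^ p * ∑ j ∈ Finset.range E.1, dist (E.2 j).1 (E.2 j).2 := by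
    intro M hM E hE
    have lim : Tendsto (fun i => p * M ^ (p - 1) * ∑ j ∈ Finset.range E.1,
        dist (∫ u in (0 : ℝ)..(E.2 j).1, h i u) (∫ u in (0 : ℝ)..(E.2 j).2, h i u)) l
        (𝓝 (p * M ^ (p - 1) * ∑ j ∈ Finset.range E.1, dist (F (E.2 j).1) (F (E.2 j).2))) := by
      refine (tendsto_finsetSum _ fun j hj => ?_).const_mul _
      have hj' := hE.1 j hj
      rw [uIcc_of_le ht] at hj'
      exact (hF _ hj'.1).dist (hF _ hj'.2)
    refine le_of_tendsto lim (Eventually.of_forall fun i => ?_)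
    have key : ∀ x ∈ Icc 0 t, ∀ y ∈ Icc 0 t, x ≤ y → p * M ^ (p - 1) *
        dist (∫ u in (0 : ℝ)..x, h i u) (∫ u in (0 : ℝ)..y, h i u) ≤
        (∫ u in uIoc x y, h i u ^ p) + (p - 1) * M ^ p * dist x y := by
      intro x hx y hy hxy
      have h1 := integral_rpow_tangent_le hp (hh i) (hhp i) (h0 i) hx.1 hxy hy.2 hM.le
      have h2 : 0 ≤ ∫ s in x..y, h i s := by
        refine intervalIntegral.integral_nonneg_of_ae_restrict hxy ?_
        exact ae_restrict_of_ae_restrict_of_subset (Icc_subset_Icc hx.1 hy.2) (h0 i)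
      rw [_root_.dist_comm, Real.dist_eq, intervalIntegral_sub_of_le (hh i) hx.1 hxy hy.2,
        abs_of_nonneg h2, uIoc_of_le hxy, ← intervalIntegral.integral_of_le hxy,
        _root_.dist_comm, Real.dist_eq, abs_of_nonneg (sub_nonneg.2 hxy)]
      have e : p * M ^ (p - 1) * (M * (y - x)) = p * (M ^ p * (y - x)) := by
        rw [Real.rpow_sub_one hM.ne']
        field_simp
      linarith
    have key' : ∀ x ∈ Icc 0 t, ∀ y ∈ Icc 0 t, p * M ^ (p - 1) *
        dist (∫ u in (0 : ℝ)..x, h i u) (∫ u in (0 : ℝ)..y, h i u) ≤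
        (∫ u in uIoc x y, h i u ^ p) + (p - 1) * M ^ p * dist x y := by
      intro x hx y hy
      rcases le_total x y with hxy | hxy
      · exact key x hx y hy hxy
      · rw [_root_.dist_comm, uIoc_comm, _root_.dist_comm x y]
        exact key y hy x hx hxy
    have hpi : IntegrableOn (fun u => h i u ^ p) (uIoc 0 t) volume :=
      intervalIntegrable_iff.1 (hhp i)
    rw [Finset.mul_sum, Finset.mul_sum]
    calc _ ≤ ∑ j ∈ Finset.range E.1, ((∫ u in uIoc (E.2 j).1 (E.2 j).2, h i u ^ p) +
          (p - 1) * M ^ p * dist (E.2 j).1 (E.2 j).2) := by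
          refine Finset.sum_le_sum fun j hj => ?_
          have hj' := hE.1 j hj
          rw [uIcc_of_le ht] at hj'
          exact key' _ hj'.1 _ hj'.2
      _ ≤ _ := by
          rw [Finset.sum_add_distrib]
          gcongr
          refine le_trans ?_ (hK i)
          rw [← integral_biUnion_finset _ (by simp [uIoc]) hE.2 fun j hj =>
              hpi.mono_set (uIoc_subset_of_mem_disjWithin hE (Finset.mem_range.1 hj)),
            intervalIntegral.integral_of_le ht, ← uIoc_of_le ht]
          refine setIntegral_mono_set hpi ?_
            (LE.le.eventuallyLE (biUnion_uIoc_subset_of_mem_disjWithin hE))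
          rw [uIoc_of_le ht]
          filter_upwards [ae_restrict_of_ae_restrict_of_subset Ioc_subset_Icc_self (h0 i)]
            with u hu
          exact Real.rpow_nonneg hu p
  rw [absolutelyContinuousOnInterval_iff]
  intro ε hε
  have hp1 : 0 < p - 1 := by linarith
  -- A large slope `M` reduces the contribution of `K` to less than `ε / 2`; `δ` is then chosen so
  -- that the length term contributes less than `ε / 2`.
  obtain ⟨M, hM, hMK⟩ : ∃ M > 0, K < p * M ^ (p - 1) * (ε / 2) := by
    have h1 : Tendsto (fun M : ℝ => p * M ^ (p - 1) * (ε / 2)) atTop atTop :=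
      ((_root_.tendsto_rpow_atTop hp1).const_mul_atTop (by linarith)).atTop_mul_const (by linarith)
    obtain ⟨M, hM⟩ := ((eventually_gt_atTop 0).and (h1.eventually_gt_atTop K)).exists
    exact ⟨M, hM⟩
  have hc : 0 < p * M ^ (p - 1) := by positivity
  have hc' : 0 < (p - 1) * M ^ p := by positivity
  refine ⟨p * M ^ (p - 1) * (ε / 2) / ((p - 1) * M ^ p), by positivity, fun E hE hEδ => ?_⟩
  rw [lt_div_iff₀ hc'] at hEδ
  have := step M hM E hE
  refine lt_of_mul_lt_mul_left ?_ hc.le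
  linarith

/-- The limit speed is `F'`. The tangent inequality passes to increments of `F` and `Φ`, and
differentiating it compares `(F')^p` with `Φ'`. -/
theorem exists_limit_speed (hp : 1 < p) (ht : 0 ≤ t) {ι : Type*}
    {l : Filter ι} [l.NeBot] {h : ι → ℝ → ℝ} (hh : ∀ i, IntervalIntegrable (h i) volume 0 t)
    (hhp : ∀ i, IntervalIntegrable (fun s => h i s ^ p) volume 0 t)
    (h0 : ∀ i, 0 ≤ᵐ[volume.restrict (Icc 0 t)] h i) {K : ℝ}
    (hK : ∀ i, ∫ s in (0 : ℝ)..t, h i s ^ p ≤ K) {F Φ : ℝ → ℝ}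
    (hF : ∀ s ∈ Icc 0 t, Tendsto (fun i => ∫ u in (0 : ℝ)..s, h i u) l (𝓝 (F s)))
    (hΦ : ∀ s ∈ Icc 0 t, Tendsto (fun i => ∫ u in (0 : ℝ)..s, h i u ^ p) l (𝓝 (Φ s))) :
    ∃ g : ℝ → ℝ, MemLp g (ENNReal.ofReal p) (volume.restrict (Icc 0 t)) ∧
      0 ≤ᵐ[volume.restrict (Icc 0 t)] g ∧
      (∀ a b, 0 ≤ a → a ≤ b → b ≤ t → ∫ s in a..b, g s = F b - F a) ∧
      ∫ s in (0 : ℝ)..t, g s ^ p ≤ Φ t := by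
  have hAC := AbsolutelyContinuousOnInterval.of_tendsto_primitive hp ht hh hhp h0 hK hF
  have hint : ∀ a b, 0 ≤ a → a ≤ b → b ≤ t → ∫ s in a..b, deriv F s = F b - F a := by
    intro a b ha hab hb
    refine (hAC.mono ?_).integral_deriv_eq_sub
    rw [uIcc_of_le hab, uIcc_of_le ht]
    exact Icc_subset_Icc ha hb
  have hsub : ∀ a b, 0 ≤ a → a ≤ b → b ≤ t →
      Tendsto (fun i => ∫ u in a..b, h i u) l (𝓝 (F b - F a)) := by
    intro a b ha hab hb
    refine ((hF b ⟨ha.trans hab, hb⟩).sub (hF a ⟨ha, hab.trans hb⟩)).congr fun i => ?_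
    exact intervalIntegral_sub_of_le (hh i) ha hab hb
  have hsubΦ : ∀ a b, 0 ≤ a → a ≤ b → b ≤ t →
      Tendsto (fun i => ∫ u in a..b, h i u ^ p) l (𝓝 (Φ b - Φ a)) := by
    intro a b ha hab hb
    refine ((hΦ b ⟨ha.trans hab, hb⟩).sub (hΦ a ⟨ha, hab.trans hb⟩)).congr fun i => ?_
    exact intervalIntegral_sub_of_le (hhp i) ha hab hb
  have hnn : ∀ a b, 0 ≤ a → a ≤ b → b ≤ t → 0 ≤ F b - F a := by
    intro a b ha hab hb
    refine ge_of_tendsto (hsub a b ha hab hb) (Eventually.of_forall fun i => ?_)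
    refine intervalIntegral.integral_nonneg_of_ae_restrict hab ?_
    exact ae_restrict_of_ae_restrict_of_subset (Icc_subset_Icc ha hb) (h0 i)
  have tangent : ∀ a b, 0 ≤ a → a ≤ b → b ≤ t → ∀ M, 0 ≤ M →
      M ^ p * (b - a) + p * M ^ (p - 1) * (F b - F a - M * (b - a)) ≤ Φ b - Φ a := by
    intro a b ha hab hb M hM
    refine le_of_tendsto_of_tendsto ((((hsub a b ha hab hb).sub_const _).const_mul _).const_add _)
      (hsubΦ a b ha hab hb) (Eventually.of_forall fun i => ?_)
    exact integral_rpow_tangent_le hp (hh i) (hhp i) (h0 i) ha hab hb hM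
  have g0 : 0 ≤ᵐ[volume.restrict (Icc 0 t)] deriv F := by
    refine ae_le_of_forall_intervalIntegral_le (f := fun _ => 0) intervalIntegrable_const
      hAC.intervalIntegrable_deriv ?_
    intro a b ha hab hb
    rw [hint a b ha hab hb]
    simpa using hnn a b ha hab hb
  have hΦmono : MonotoneOn Φ (Icc 0 t) := by
    intro a ha b hb hab
    have := tangent a b ha.1 hab hb.2 0 le_rfl
    rw [Real.zero_rpow (by linarith), Real.zero_rpow (by linarith)] at this
    linarith
  have hΦ0 : Φ 0 = 0 := by
    have h1 := hΦ 0 ⟨le_rfl, ht⟩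
    simp only [intervalIntegral.integral_same] at h1
    exact tendsto_nhds_unique h1 tendsto_const_nhds
  have hΦint : IntervalIntegrable (deriv Φ) volume 0 t :=
    MonotoneOn.intervalIntegrable_deriv (by rwa [uIcc_of_le ht])
  have hle : (fun s => deriv F s ^ p) ≤ᵐ[volume.restrict (Icc 0 t)] deriv Φ := by
    rw [EventuallyLE, ← restrict_Ioo_eq_restrict_Icc]
    rw [← restrict_Ioo_eq_restrict_Icc] at g0
    filter_upwards [g0, (hΦmono.mono Ioo_subset_Icc_self).ae_differentiableWithinAt
      measurableSet_Ioo, ae_restrict_of_ae hAC.ae_differentiableAt,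
      ae_restrict_mem measurableSet_Ioo] with x hx hxΦ hxF hxt
    have dΦ := (hxΦ.differentiableAt (isOpen_Ioo.mem_nhds hxt)).hasDerivAt
    have dF := (hxF (by rw [uIcc_of_le ht]; exact Ioo_subset_Icc_self hxt)).hasDerivAt
    set M := deriv F x
    -- With the slope frozen at `M = F'(x)`, the linear term has zero derivative at `x`, and
    -- monotonicity of the difference gives `M ^ p ≤ Φ'(x)`.
    have dd := dΦ.sub (((hasDerivAt_id x).const_mul (M ^ p)).add
      ((dF.sub ((hasDerivAt_id x).const_mul M)).const_mul (p * M ^ (p - 1))))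
    have := dd.hasDerivWithinAt.nonneg_of_monotoneOn (s := Ioo 0 t)
      (uniqueDiffWithinAt_iff_accPt.1 (isOpen_Ioo.uniqueDiffWithinAt hxt)) (by
        intro a ha b hb hab
        have := tangent a b ha.1.le hab hb.2.le M hx
        simp only [Pi.sub_apply, Pi.add_apply, id]
        linarith)
    simp only [M] at this ⊢
    linarith
  have gp : IntervalIntegrable (fun s => deriv F s ^ p) volume 0 t := by
    rw [intervalIntegrable_iff_integrableOn_Icc_of_le ht] at hΦint ⊢
    refine Integrable.mono' hΦint
      ((measurable_deriv F).pow_const p).aestronglyMeasurable ?_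
    filter_upwards [hle, g0] with s hs hs0
    rwa [Real.norm_of_nonneg (Real.rpow_nonneg hs0 p)]
  refine ⟨deriv F, (memLp_Icc_iff hp ht (measurable_deriv F).aestronglyMeasurable g0).2 gp, g0,
    hint, ?_⟩
  calc ∫ s in (0 : ℝ)..t, deriv F s ^ p ≤ ∫ s in (0 : ℝ)..t, deriv Φ s :=
        intervalIntegral.integral_mono_ae_restrict ht gp hΦint hle
    -- Only an inequality: `Φ` is merely monotone and may have a singular part, where energy
    -- concentrates in the limit.
    _ ≤ Φ t := by
        have := MonotoneOn.intervalIntegral_deriv_mem_uIcc (f := Φ) (a := 0) (b := t)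
          (by rwa [uIcc_of_le ht])
        rw [hΦ0, sub_zero, uIcc_of_le (by
          rw [← hΦ0]; exact hΦmono ⟨le_rfl, ht⟩ ⟨ht, le_rfl⟩ ht)] at this
        exact this.2

end LimitOfSpeeds

/-! ### Convergence of integrals and of bounded real families -/

section RealLemmas

theorem Real.add_rpow_le_mul_rpow_add_rpow {a b p : ℝ} (ha : 0 ≤ a) (hb : 0 ≤ b) (hp : 1 ≤ p) :
    (a + b) ^ p ≤ 2 ^ (p - 1) * (a ^ p + b ^ p) := by
  lift a to ℝ≥0 using ha
  lift b to ℝ≥0 using hb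
  exact_mod_cast NNReal.rpow_add_le_mul_rpow_add_rpow a b hp

/-- Dominated convergence can fail along an ultrafilter. Equicontinuity on a compact interval
upgrades pointwise to uniform convergence, which works for every filter. -/
theorem tendsto_intervalIntegral_of_equicontinuous {ι : Type*} {l : Filter ι} {t : ℝ}
    (ht : 0 ≤ t) {f : ι → ℝ → ℝ} {g : ℝ → ℝ}
    (hf : ∀ i, ContinuousOn (f i) (Icc 0 t)) (hg : ContinuousOn g (Icc 0 t))
    (heq : ∀ ε > 0, ∃ δ > 0, ∀ i, ∀ a ∈ Icc 0 t, ∀ b ∈ Icc 0 t, |a - b| < δ →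
      |f i a - f i b| < ε)
    (hlim : ∀ s ∈ Icc 0 t, Tendsto (fun i => f i s) l (𝓝 (g s))) :
    Tendsto (fun i => ∫ s in (0 : ℝ)..t, f i s) l (𝓝 (∫ s in (0 : ℝ)..t, g s)) := by
  have hequi : Equicontinuous fun i (s : Icc (0 : ℝ) t) => f i s := by
    refine UniformEquicontinuous.equicontinuous (Metric.uniformEquicontinuous_iff.2 fun ε hε => ?_)
    obtain ⟨δ, hδ, H⟩ := heq ε hε
    exact ⟨δ, hδ, fun x y hxy i => H i x x.2 y y.2 hxy⟩
  have hunif := (hequi.tendsto_uniformFun_iff_pi l fun s => g s).2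
    (tendsto_pi_nhds.2 fun s => hlim s s.2)
  rw [UniformFun.tendsto_iff_tendstoUniformly] at hunif
  have hunif' := Metric.tendstoUniformly_iff.1 hunif
  rw [Metric.tendsto_nhds]
  intro ε hε
  filter_upwards [hunif' (ε / (t + 1)) (by positivity)] with i hi
  rw [Real.dist_eq, ← intervalIntegral.integral_sub
    ((hf i).intervalIntegrable_of_Icc ht) (hg.intervalIntegrable_of_Icc ht)]
  have h1 : ‖∫ s in (0 : ℝ)..t, (f i s - g s)‖ ≤ ε / (t + 1) * |t - 0| := by
    refine intervalIntegral.norm_integral_le_of_norm_le_const fun s hs => ?_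
    rw [uIoc_of_le ht] at hs
    have := hi ⟨s, Ioc_subset_Icc_self hs⟩
    rw [Real.dist_eq, abs_sub_comm] at this
    exact this.le
  rw [Real.norm_eq_abs, sub_zero, abs_of_nonneg ht] at h1
  refine lt_of_le_of_lt h1 ?_
  rw [div_mul_eq_mul_div, div_lt_iff₀ (by positivity)]
  nlinarith

theorem Ultrafilter.exists_tendsto_of_mem_Icc {ι : Type*} (U : Ultrafilter ι) {f : ι → ℝ}
    {a b : ℝ} (h : ∀ i, f i ∈ Icc a b) : ∃ x, Tendsto f U (𝓝 x) := by
  obtain ⟨x, -, hx⟩ := isCompact_Icc.ultrafilter_le_nhds' (U.map f)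
    (Filter.mem_map.2 (Filter.Eventually.of_forall h))
  exact ⟨x, hx⟩

end RealLemmas

/-! ### Metric derivative, energy and equicontinuity of paths -/

namespace WassersteinSpace

variable {d : ℕ} {p : ℝ}

theorem IsSpeedBound.intervalIntegrable (hp : 1 < p) {t : ℝ} (ht : 0 ≤ t)
    {σ : ℝ → WassersteinSpace d p} {h : ℝ → ℝ} (hσ : IsSpeedBound t σ h) :
    IntervalIntegrable h volume 0 t :=
  hσ.1.intervalIntegrable_Icc hp ht

theorem IsSpeedBound.ae_nonneg (hp : 1 < p) {t : ℝ} (ht : 0 ≤ t)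
    {σ : ℝ → WassersteinSpace d p} {h : ℝ → ℝ} (hσ : IsSpeedBound t σ h) :
    0 ≤ᵐ[volume.restrict (Icc 0 t)] h := by
  let _ := pseudoMetricSpace (d := d) hp.le
  exact ae_nonneg_of_dist_le_integral (σ := σ) (hσ.intervalIntegrable hp ht) hσ.2

theorem IsSpeedBound.intervalIntegrable_rpow (hp : 1 < p) {t : ℝ} (ht : 0 ≤ t)
    {σ : ℝ → WassersteinSpace d p} {h : ℝ → ℝ} (hσ : IsSpeedBound t σ h) :
    IntervalIntegrable (fun s => h s ^ p) volume 0 t :=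
  (memLp_Icc_iff hp ht hσ.1.1 (hσ.ae_nonneg hp ht)).1 hσ.1

/-- The minimal integrable speed is nonnegative and lies below a speed bound in `L^p`, hence is
itself in `L^p`. -/
theorem IsACPath.isMetricDeriv (hp : 1 < p) {t : ℝ} (ht : 0 ≤ t) {σ : ℝ → WassersteinSpace d p}
    (hσ : IsACPath t σ) : IsMetricDeriv t σ (metricDeriv t σ) := by
  have H : ∃ h : ℝ → ℝ, IsMetricDeriv t σ h := by
    obtain ⟨h, hh⟩ := hσ
    let _ := pseudoMetricSpace (d := d) hp.le
    obtain ⟨m, hm, hmσ, hmin⟩ := exists_minimal_speed (σ := σ) ht (hh.intervalIntegrable hp ht) hh.2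
    have m0 := ae_nonneg_of_dist_le_integral hm hmσ
    refine ⟨m, ⟨?_, hmσ⟩, fun g hg => hmin g (hg.intervalIntegrable hp ht) hg.2⟩
    refine hh.1.mono ((intervalIntegrable_iff_integrableOn_Icc_of_le ht).1 hm).1 ?_
    filter_upwards [m0, hmin h (hh.intervalIntegrable hp ht) hh.2] with s hs0 hs
    rw [Real.norm_of_nonneg hs0]
    exact hs.trans (le_abs_self _)
  rw [metricDeriv, dif_pos H]
  exact H.choose_spec

theorem IsACPath.isSpeedBound (hp : 1 < p) {t : ℝ} (ht : 0 ≤ t) {σ : ℝ → WassersteinSpace d p}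
    (hσ : IsACPath t σ) : IsSpeedBound t σ (metricDeriv t σ) :=
  (hσ.isMetricDeriv hp ht).1

/-- The `p`-energy of a path. -/
noncomputable def energy (t : ℝ) (σ : ℝ → WassersteinSpace d p) : ℝ :=
  ∫ s in (0 : ℝ)..t, metricDeriv t σ s ^ p

theorem IsSpeedBound.integral_rpow_mono (hp : 1 < p) {t : ℝ} (ht : 0 ≤ t)
    {σ : ℝ → WassersteinSpace d p} {h : ℝ → ℝ} (hσ : IsSpeedBound t σ h)
    {a b : ℝ} (ha : 0 ≤ a) (hab : a ≤ b) (hb : b ≤ t) :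
    ∫ s in a..b, h s ^ p ≤ ∫ s in (0 : ℝ)..t, h s ^ p := by
  have hi := hσ.intervalIntegrable_rpow hp ht
  refine intervalIntegral.integral_mono_interval ha hab hb ?_ hi
  filter_upwards [ae_restrict_of_ae_restrict_of_subset Ioc_subset_Icc_self (hσ.ae_nonneg hp ht)]
    with s hs
  exact Real.rpow_nonneg hs p

theorem IsACPath.energy_nonneg (hp : 1 < p) {t : ℝ} (ht : 0 ≤ t) {σ : ℝ → WassersteinSpace d p}
    (hσ : IsACPath t σ) : 0 ≤ energy t σ := by
  have := (hσ.isSpeedBound hp ht).integral_rpow_mono hp ht (a := 0) (b := 0) le_rfl le_rfl ht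
  simpa [energy] using this

theorem IsSpeedBound.energy_le (hp : 1 < p) {t : ℝ} (ht : 0 ≤ t) {σ : ℝ → WassersteinSpace d p}
    {h : ℝ → ℝ} (hσ : IsSpeedBound t σ h) : energy t σ ≤ ∫ s in (0 : ℝ)..t, h s ^ p := by
  have hac : IsACPath t σ := ⟨h, hσ⟩
  have hm := hac.isMetricDeriv hp ht
  refine intervalIntegral.integral_mono_ae_restrict ht (hm.1.intervalIntegrable_rpow hp ht)
    (hσ.intervalIntegrable_rpow hp ht) ?_
  filter_upwards [hm.2 h hσ, hm.1.ae_nonneg hp ht] with s hs hs0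
  exact Real.rpow_le_rpow hs0 hs (by linarith)

/-- A Young-type bound with free parameter: `M = 1` gives boundedness of paths, large `M` gives
equicontinuity and absorbs Lipschitz terms. -/
theorem IsACPath.mul_integral_le (hp : 1 < p) {t : ℝ} (ht : 0 ≤ t) {σ : ℝ → WassersteinSpace d p}
    (hσ : IsACPath t σ) {a b : ℝ} (ha : 0 ≤ a) (hab : a ≤ b) (hb : b ≤ t) {M : ℝ} (hM : 0 < M) :
    p * M ^ (p - 1) * ∫ s in a..b, metricDeriv t σ s ≤
      energy t σ + (p - 1) * M ^ p * (b - a) := by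
  have hs := hσ.isSpeedBound hp ht
  have h1 := integral_rpow_tangent_le hp (hs.intervalIntegrable hp ht)
    (hs.intervalIntegrable_rpow hp ht) (hs.ae_nonneg hp ht) ha hab hb hM.le
  have h2 := hs.integral_rpow_mono hp ht ha hab hb
  have e : p * M ^ (p - 1) * (M * (b - a)) = p * (M ^ p * (b - a)) := by
    rw [Real.rpow_sub_one hM.ne']
    field_simp
  rw [energy]
  linarith

theorem IsACPath.mul_dist_le (hp : 1 < p) {t : ℝ} (ht : 0 ≤ t) {σ : ℝ → WassersteinSpace d p}
    (hσ : IsACPath t σ) {a b : ℝ} (ha : 0 ≤ a) (hab : a ≤ b) (hb : b ≤ t) {M : ℝ} (hM : 0 < M) :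
    p * M ^ (p - 1) * dist (σ a) (σ b) ≤ energy t σ + (p - 1) * M ^ p * (b - a) := by
  refine le_trans ?_ (hσ.mul_integral_le hp ht ha hab hb hM)
  have := (hσ.isSpeedBound hp ht).2 a b ha hab hb
  gcongr

/-- Paths of bounded energy are equicontinuous. -/
theorem exists_modulus_of_energy_le (hp : 1 < p) {t : ℝ} (ht : 0 ≤ t) (K : ℝ) {ε : ℝ}
    (hε : 0 < ε) :
    ∃ δ > 0, ∀ σ : ℝ → WassersteinSpace d p, IsACPath t σ → energy t σ ≤ K →
      ∀ a ∈ Icc 0 t, ∀ b ∈ Icc 0 t, |a - b| < δ → dist (σ a) (σ b) < ε := by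
  have hp1 : 0 < p - 1 := by linarith
  obtain ⟨M, hM, hMK⟩ : ∃ M > 0, K < p * M ^ (p - 1) * (ε / 2) := by
    have h1 : Tendsto (fun M : ℝ => p * M ^ (p - 1) * (ε / 2)) atTop atTop :=
      ((_root_.tendsto_rpow_atTop hp1).const_mul_atTop (by linarith)).atTop_mul_const
        (by linarith)
    obtain ⟨M, hM⟩ := ((eventually_gt_atTop 0).and (h1.eventually_gt_atTop K)).exists
    exact ⟨M, hM⟩
  have hc : 0 < p * M ^ (p - 1) := by positivity
  have hc' : 0 < (p - 1) * M ^ p := by positivity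
  have key : ∀ σ : ℝ → WassersteinSpace d p, IsACPath t σ → energy t σ ≤ K →
      ∀ a ∈ Icc 0 t, ∀ b ∈ Icc 0 t, a ≤ b →
      |a - b| < p * M ^ (p - 1) * (ε / 2) / ((p - 1) * M ^ p) → dist (σ a) (σ b) < ε := by
    intro σ hσ hK a ha b hb hab hδ
    rw [abs_sub_comm, abs_of_nonneg (sub_nonneg.2 hab), lt_div_iff₀ hc'] at hδ
    have := hσ.mul_dist_le hp ht ha.1 hab hb.2 hM
    refine lt_of_mul_lt_mul_left ?_ hc.le
    linarith
  refine ⟨p * M ^ (p - 1) * (ε / 2) / ((p - 1) * M ^ p), by positivity,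
    fun σ hσ hK a ha b hb hδ => ?_⟩
  rcases le_total a b with hab | hab
  · exact key σ hσ hK a ha b hb hab hδ
  · rw [dist_comm hp.le]
    rw [abs_sub_comm] at hδ
    exact key σ hσ hK b hb a ha hab hδ

theorem IsACPath.continuousOn_dist (hp : 1 < p) {t : ℝ} (ht : 0 ≤ t)
    {σ : ℝ → WassersteinSpace d p} (hσ : IsACPath t σ) (ν : WassersteinSpace d p) :
    ContinuousOn (fun s => dist (σ s) ν) (Icc 0 t) := by
  rw [Metric.continuousOn_iff]
  intro b hb ε hε
  obtain ⟨δ, hδ, H⟩ := exists_modulus_of_energy_le (d := d) hp ht (energy t σ) hε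
  refine ⟨δ, hδ, fun a ha hab => ?_⟩
  have h1 := H σ hσ le_rfl a ha b hb hab
  have h2 := dist_triangle hp.le (σ a) (σ b) ν
  have h3 := dist_triangle hp.le (σ b) (σ a) ν
  rw [dist_comm hp.le (σ b) (σ a)] at h3
  rw [Real.dist_eq, abs_lt]
  constructor <;> linarith

/-- Paths of bounded energy with a fixed endpoint have bounded moments. -/
theorem exists_moment_bound (hp : 1 < p) {t : ℝ} (ht : 0 ≤ t) (μ : WassersteinSpace d p) (K : ℝ) :
    ∃ R : ℝ≥0∞, R ≠ ∞ ∧ ∀ σ : ℝ → WassersteinSpace d p, IsAdmissible μ t σ → energy t σ ≤ K →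
      ∀ s ∈ Icc 0 t, (σ s).moment ≤ R := by
  obtain ⟨R, hR, H⟩ := moment_le_of_dist_le hp.le μ ((K + (p - 1) * t) / p)
  refine ⟨R, hR, fun σ hσ hK s hs => H _ ?_⟩
  have h1 := hσ.1.mul_dist_le hp ht hs.1 hs.2 le_rfl one_pos
  rw [hσ.2, Real.one_rpow, Real.one_rpow] at h1
  rw [le_div_iff₀ (by linarith)]
  have h2 : (p - 1) * (t - s) ≤ (p - 1) * t :=
    mul_le_mul_of_nonneg_left (by linarith [hs.1]) (by linarith)
  linarith

theorem NarrowlyContinuous.exists_modulus (hp : 1 < p) {t : ℝ} (ht : 0 ≤ t)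
    {V : WassersteinSpace d p → ℝ} (hV : NarrowlyContinuous V) (μ : WassersteinSpace d p) (K : ℝ)
    {ε : ℝ} (hε : 0 < ε) :
    ∃ δ > 0, ∀ σ : ℝ → WassersteinSpace d p, IsAdmissible μ t σ → energy t σ ≤ K →
      ∀ a ∈ Icc 0 t, ∀ b ∈ Icc 0 t, |a - b| < δ → |V (σ a) - V (σ b)| < ε := by
  obtain ⟨R, hR, hmom⟩ := exists_moment_bound hp ht μ K
  obtain ⟨η, hη, hVη⟩ := hV.uniformly hp.le hR hε
  obtain ⟨δ, hδ, H⟩ := exists_modulus_of_energy_le (d := d) hp ht K hη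
  exact ⟨δ, hδ, fun σ hσ hK a ha b hb hab => hVη _ _ (hmom σ hσ hK a ha) (hmom σ hσ hK b hb)
    (H σ hσ.1 hK a ha b hb hab)⟩

theorem NarrowlyContinuous.continuousOn_comp (hp : 1 < p) {t : ℝ} (ht : 0 ≤ t)
    {V : WassersteinSpace d p → ℝ} (hV : NarrowlyContinuous V)
    {σ : ℝ → WassersteinSpace d p} (hσ : IsACPath t σ) :
    ContinuousOn (fun s => V (σ s)) (Icc 0 t) := by
  rw [Metric.continuousOn_iff]
  intro b hb ε hε
  obtain ⟨δ, hδ, H⟩ := hV.exists_modulus hp ht (σ t) (energy t σ) hε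
  exact ⟨δ, hδ, fun a ha hab => H σ ⟨hσ, rfl⟩ le_rfl a ha b hb hab⟩

/-! ### The action: coercivity and lower semicontinuity -/

theorem action_eq (hp : 1 < p) {t : ℝ} (ht : 0 ≤ t) (G : WassersteinSpace d p → ℝ)
    {V : WassersteinSpace d p → ℝ} (hV : NarrowlyContinuous V)
    {σ : ℝ → WassersteinSpace d p} (hσ : IsACPath t σ) :
    action G V t σ = G (σ 0) + (1 / p * energy t σ - ∫ s in (0 : ℝ)..t, V (σ s)) := by
  rw [action, intervalIntegral.integral_sub
    (((hσ.isSpeedBound hp ht).intervalIntegrable_rpow hp ht).const_mul _)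
    ((hV.continuousOn_comp hp ht hσ).intervalIntegrable_of_Icc ht),
    intervalIntegral.integral_const_mul, energy]

theorem isAdmissible_const (hp : 1 < p) (t : ℝ) (μ : WassersteinSpace d p) :
    IsAdmissible μ t fun _ => μ :=
  ⟨⟨0, MemLp.zero, fun s₁ s₂ _ _ _ => by simp [dist_self hp.le]⟩, rfl⟩

/-- The Poincaré inequality holds with constant `1`. -/
theorem poincareInequality_one (d : ℕ) (hp : 1 < p) : PoincareInequality d p 1 := by
  intro T σ hT hσ
  have hp0 : 0 < p := by linarith
  have hs := hσ.isSpeedBound hp hT.le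
  set m := metricDeriv T σ
  set I := ∫ s in (0 : ℝ)..T, m s
  have hi := hs.intervalIntegrable hp hT.le
  have hm0 : ∀ a b, 0 ≤ a → a ≤ b → b ≤ T → 0 ≤ ∫ s in a..b, m s := fun a b ha hab hb =>
    (dist_nonneg _ _).trans (hs.2 a b ha hab hb)
  have hI : 0 ≤ I := hm0 0 T le_rfl hT.le le_rfl
  have hdist : ∀ s ∈ Icc 0 T, dist (σ s) (σ T) ^ p ≤ I ^ p := by
    intro s hs'
    refine Real.rpow_le_rpow (dist_nonneg _ _) ?_ hp0.le
    have h1 := intervalIntegral_sub_of_le hi hs'.1 hs'.2 le_rfl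
    have h2 := hm0 0 s le_rfl hs'.1 hs'.2
    have h3 := hs.2 s T hs'.1 hs'.2 le_rfl
    linarith
  have h1 : ∫ s in (0 : ℝ)..T, dist (σ s) (σ T) ^ p ≤ T * I ^ p := by
    have := intervalIntegral.integral_mono_on (μ := volume) hT.le
      (((hσ.continuousOn_dist hp hT.le (σ T)).rpow_const
        fun _ _ => Or.inr hp0.le).intervalIntegrable_of_Icc hT.le)
      (intervalIntegrable_const (c := I ^ p)) hdist
    simpa using this
  have h2 : T * I ^ p ≤ T ^ p * energy T σ := by
    -- At the mean speed `I / T` the linear term vanishes, leaving Jensen's inequality.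
    have h3 := integral_rpow_tangent_le hp hi (hs.intervalIntegrable_rpow hp hT.le)
      (hs.ae_nonneg hp hT.le) le_rfl hT.le le_rfl (M := I / T) (by positivity)
    have h4 : I / T * (T - 0) = I := by field_simp; ring
    rw [h4, sub_self, mul_zero, add_zero, Real.div_rpow hI hT.le, sub_zero] at h3
    have hTp : 0 < T ^ p := by positivity
    rw [div_mul_eq_mul_div, div_le_iff₀ hTp] at h3
    rw [energy]
    linarith
  have hnn : 0 ≤ ∫ s in (0 : ℝ)..T, dist (σ s) (σ T) ^ p :=
    intervalIntegral.integral_nonneg hT.le fun s _ => Real.rpow_nonneg (dist_nonneg _ _) p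
  calc (∫ s in (0 : ℝ)..T, dist (σ s) (σ T) ^ p) ^ (1 / p)
      ≤ (T ^ p * energy T σ) ^ (1 / p) :=
        Real.rpow_le_rpow hnn (h1.trans h2) (by positivity)
    _ = 1 * T * (energy T σ) ^ (1 / p) := by
        rw [Real.mul_rpow (by positivity) (hσ.energy_nonneg hp hT.le), ← Real.rpow_mul hT.le,
          mul_one_div_cancel hp0.ne', Real.rpow_one, one_mul]

/-- The smallness condition is open in the constant, so an admissible `C` slightly above the infimum
works and attainment is not needed. -/
theorem exists_poincare_constant (d : ℕ) (hp : 1 < p) {T α : ℝ}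
    (h : p * (2 * poincareConst d p * T) ^ p * α < 1) :
    ∃ C > 0, PoincareInequality d p C ∧ p * (2 * C * T) ^ p * α < 1 := by
  have hcont : ContinuousAt (fun c : ℝ => p * (2 * c * T) ^ p * α) (poincareConst d p) := by
    refine ((ContinuousAt.rpow_const (by fun_prop) (Or.inr (by linarith))).const_mul p).mul_const α
  obtain ⟨ε, hε, H⟩ := Metric.eventually_nhds_iff.1 (hcont.eventually (gt_mem_nhds h))
  obtain ⟨C, hC, hCε⟩ := exists_lt_of_csInf_lt (s := {C : ℝ | 0 < C ∧ PoincareInequality d p C})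
    ⟨1, one_pos, poincareInequality_one d hp⟩ (lt_add_of_pos_right (poincareConst d p) hε)
  refine ⟨C, hC.1, hC.2, H ?_⟩
  have hle : poincareConst d p ≤ C := csInf_le ⟨0, fun x hx => hx.1.le⟩ hC
  rw [Real.dist_eq, abs_of_nonneg (sub_nonneg.2 hle)]
  linarith

/-- The action controls the energy. -/
theorem exists_energy_le_action (hp : 1 < p) {G V : WassersteinSpace d p → ℝ}
    (hGLip : IsLipschitz G) {α β : ℝ} (hα : 0 ≤ α) {ϱ : WassersteinSpace d p}
    (hVgrowth : ∀ μ : WassersteinSpace d p, V μ ≤ α * dist μ ϱ ^ p + β)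
    (hV : NarrowlyContinuous V) {t C : ℝ} (ht : 0 < t) (hC : 0 < C)
    (hPoin : PoincareInequality d p C) (hsmall : p * (2 * C * t) ^ p * α < 1)
    (μ : WassersteinSpace d p) :
    ∃ c : ℝ, ∀ σ : ℝ → WassersteinSpace d p, IsAdmissible μ t σ →
      1 / (4 * p) * energy t σ - c ≤ action G V t σ := by
  have hp0 : 0 < p := by linarith
  obtain ⟨L, hL⟩ := hGLip
  -- This choice lets the Lipschitz term use at most `1 / (4 * p)` of the energy.
  obtain ⟨M, hM, hML⟩ : ∃ M > 0, 4 * |L| ≤ M ^ (p - 1) := by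
    obtain ⟨M, hM⟩ := ((eventually_gt_atTop 0).and ((_root_.tendsto_rpow_atTop
      (show 0 < p - 1 by linarith)).eventually_ge_atTop (4 * |L|))).exists
    exact ⟨M, hM⟩
  set D := dist μ ϱ ^ p
  refine ⟨-(G μ) + 1 / (4 * p) * ((p - 1) * M ^ p * t) + (α * 2 ^ (p - 1) * (t * D) + β * t),
    fun σ hσ => ?_⟩
  have hac := hσ.1
  set Q := energy t σ
  have hQ : 0 ≤ Q := hac.energy_nonneg hp ht.le
  have hG : G μ - 1 / (4 * p) * (Q + (p - 1) * M ^ p * t) ≤ G (σ 0) := by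
    have h1 := hac.mul_dist_le hp ht.le le_rfl ht.le le_rfl hM
    rw [hσ.2, sub_zero] at h1
    have h2 := (abs_le.1 (hL (σ 0) μ)).1
    have h3 : L * dist (σ 0) μ ≤ 1 / 4 * (M ^ (p - 1) * dist (σ 0) μ) := by
      have h4 : L * dist (σ 0) μ ≤ |L| * dist (σ 0) μ :=
        mul_le_mul_of_nonneg_right (le_abs_self L) (dist_nonneg _ _)
      have h5 := mul_le_mul_of_nonneg_right hML (dist_nonneg (σ 0) μ)
      linarith
    have h6 : M ^ (p - 1) * dist (σ 0) μ ≤ (Q + (p - 1) * M ^ p * t) / p := by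
      rw [le_div_iff₀ hp0]
      linarith
    have h7 : 1 / (4 * p) * (Q + (p - 1) * M ^ p * t) =
        1 / 4 * ((Q + (p - 1) * M ^ p * t) / p) := by
      field_simp
    rw [h7]
    linarith
  have hcont := (hac.continuousOn_dist hp ht.le μ).rpow_const (p := p)
    fun _ _ => Or.inr hp0.le
  have hint := hcont.intervalIntegrable_of_Icc (μ := volume) ht.le
  have hP : ∫ s in (0 : ℝ)..t, dist (σ s) μ ^ p ≤ (C * t) ^ p * Q := by
    have h1 := hPoin t σ ht hac
    rw [hσ.2] at h1
    change _ ≤ C * t * Q ^ (1 / p) at h1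
    have hnn : 0 ≤ ∫ s in (0 : ℝ)..t, dist (σ s) μ ^ p :=
      intervalIntegral.integral_nonneg ht.le fun s _ => Real.rpow_nonneg (dist_nonneg _ _) p
    have h2 := Real.rpow_le_rpow (Real.rpow_nonneg hnn _) h1 hp0.le
    rwa [← Real.rpow_mul hnn, one_div_mul_cancel hp0.ne', Real.rpow_one,
      Real.mul_rpow (by positivity) (Real.rpow_nonneg hQ _), ← Real.rpow_mul hQ,
      one_div_mul_cancel hp0.ne', Real.rpow_one] at h2
  have hVint : ∫ s in (0 : ℝ)..t, V (σ s) ≤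
      α * 2 ^ (p - 1) * ((C * t) ^ p * Q) + (α * 2 ^ (p - 1) * (t * D) + β * t) := by
    have hle : ∀ s ∈ Icc 0 t, V (σ s) ≤
        α * 2 ^ (p - 1) * dist (σ s) μ ^ p + (α * 2 ^ (p - 1) * D + β) := by
      intro s _
      have h1 : dist (σ s) ϱ ^ p ≤ 2 ^ (p - 1) * (dist (σ s) μ ^ p + D) :=
        (Real.rpow_le_rpow (dist_nonneg _ _) (dist_triangle hp.le _ μ _) hp0.le).trans
          (Real.add_rpow_le_mul_rpow_add_rpow (dist_nonneg _ _) (dist_nonneg _ _) hp.le)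
      have h2 := mul_le_mul_of_nonneg_left h1 hα
      have h3 := hVgrowth (σ s)
      linarith
    have h1 := intervalIntegral.integral_mono_on ht.le
      ((hV.continuousOn_comp hp ht.le hac).intervalIntegrable_of_Icc ht.le)
      ((hint.const_mul _).add intervalIntegrable_const) hle
    rw [intervalIntegral.integral_add (hint.const_mul _) intervalIntegrable_const,
      intervalIntegral.integral_const_mul, intervalIntegral.integral_const, smul_eq_mul,
      sub_zero] at h1
    have h2 := mul_le_mul_of_nonneg_left hP (show 0 ≤ α * 2 ^ (p - 1) by positivity)
    linarith
  -- The convexity factor `2 ^ (p - 1)` is half of the `2 ^ p` in the smallness condition, so `V`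
  -- uses at most half of `1 / p`.
  have hcoef : α * 2 ^ (p - 1) * ((C * t) ^ p * Q) ≤ 1 / (2 * p) * Q := by
    rw [← mul_assoc]
    refine mul_le_mul_of_nonneg_right ?_ hQ
    have h1 : (2 * C * t) ^ p = 2 * 2 ^ (p - 1) * (C * t) ^ p := by
      rw [mul_assoc, Real.mul_rpow (by norm_num) (by positivity), Real.rpow_sub_one (by norm_num)]
      ring
    rw [h1] at hsmall
    rw [le_div_iff₀ (by positivity)]
    linarith
  rw [action_eq hp ht.le G hV hac]
  have e1 : 1 / p * Q = 4 * (1 / (4 * p) * Q) := by field_simp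
  have e2 : 1 / (2 * p) * Q = 2 * (1 / (4 * p) * Q) := by field_simp; ring
  change _ ≤ G (σ 0) + (1 / p * Q - _)
  linarith

/-- Compactness and lower semicontinuity: a sequence of admissible paths of bounded energy along
which the actions converge has a limit path whose action is at most the limit. -/
theorem exists_admissible_action_le (hp : 1 < p) {G V : WassersteinSpace d p → ℝ}
    (hG : NarrowlyContinuous G) (hV : NarrowlyContinuous V) {t : ℝ} (ht : 0 ≤ t)
    {μ : WassersteinSpace d p} {σs : ℕ → ℝ → WassersteinSpace d p}
    (hσs : ∀ n, IsAdmissible μ t (σs n)) {K : ℝ} (hK : ∀ n, energy t (σs n) ≤ K) {v : ℝ}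
    (hv : Tendsto (fun n => action G V t (σs n)) atTop (𝓝 v)) :
    ∃ σ, IsAdmissible μ t σ ∧ action G V t σ ≤ v := by
  let U : Ultrafilter ℕ := hyperfilter ℕ
  have hb : ∀ n, IsSpeedBound t (σs n) (metricDeriv t (σs n)) := fun n =>
    (hσs n).1.isSpeedBound hp ht
  obtain ⟨R, hR, hmom⟩ := exists_moment_bound hp ht μ K
  -- One ultrafilter gives limits at all times at once, with no diagonal extraction; outside `[0,t]`
  -- the value is irrelevant.
  have hlim : ∀ s : ℝ, ∃ ν : WassersteinSpace d p,
      s ∈ Icc 0 t → Tendsto (fun n => (σs n s).1) U (𝓝 ν.1) := by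
    intro s
    by_cases hs : s ∈ Icc 0 t
    · obtain ⟨ν, hν⟩ := exists_tendsto_of_moment_le hp.le U hR
        (μs := fun n => σs n s) fun n => hmom _ (hσs n) (hK n) s hs
      exact ⟨ν, fun _ => hν⟩
    · exact ⟨μ, fun h => absurd h hs⟩
  choose σ hσ using hlim
  have hFlim : ∀ s : ℝ, ∃ x : ℝ, s ∈ Icc 0 t →
      Tendsto (fun n => ∫ u in (0 : ℝ)..s, metricDeriv t (σs n) u) U (𝓝 x) := by
    intro s
    by_cases hs : s ∈ Icc 0 t
    · obtain ⟨x, hx⟩ := U.exists_tendsto_of_mem_Icc (a := 0) (b := (K + (p - 1) * t) / p)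
        (f := fun n => ∫ u in (0 : ℝ)..s, metricDeriv t (σs n) u) fun n => by
          refine ⟨(dist_nonneg _ _).trans ((hb n).2 0 s le_rfl hs.1 hs.2), ?_⟩
          have h1 := (hσs n).1.mul_integral_le hp ht le_rfl hs.1 hs.2 one_pos
          rw [Real.one_rpow, Real.one_rpow] at h1
          rw [le_div_iff₀ (by linarith)]
          have h2 : (p - 1) * (s - 0) ≤ (p - 1) * t :=
            mul_le_mul_of_nonneg_left (by linarith [hs.2]) (by linarith)
          linarith [hK n]
      exact ⟨x, fun _ => hx⟩
    · exact ⟨0, fun h => absurd h hs⟩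
  choose F hF using hFlim
  have hΦlim : ∀ s : ℝ, ∃ x : ℝ, s ∈ Icc 0 t →
      Tendsto (fun n => ∫ u in (0 : ℝ)..s, metricDeriv t (σs n) u ^ p) U (𝓝 x) := by
    intro s
    by_cases hs : s ∈ Icc 0 t
    · obtain ⟨x, hx⟩ := U.exists_tendsto_of_mem_Icc (a := 0) (b := K)
        (f := fun n => ∫ u in (0 : ℝ)..s, metricDeriv t (σs n) u ^ p) fun n => by
          refine ⟨intervalIntegral.integral_nonneg_of_ae_restrict hs.1 ?_,
            ((hb n).integral_rpow_mono hp ht le_rfl hs.1 hs.2).trans (hK n)⟩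
          filter_upwards [ae_restrict_of_ae_restrict_of_subset (Icc_subset_Icc_right hs.2)
            ((hb n).ae_nonneg hp ht)] with u hu
          exact Real.rpow_nonneg hu p
      exact ⟨x, fun _ => hx⟩
    · exact ⟨0, fun h => absurd h hs⟩
  choose Φ hΦ using hΦlim
  obtain ⟨g, hgp, -, hgF, hgΦ⟩ := exists_limit_speed hp ht (l := (U : Filter ℕ))
    (h := fun n => metricDeriv t (σs n)) (fun n => (hb n).intervalIntegrable hp ht)
    (fun n => (hb n).intervalIntegrable_rpow hp ht) (fun n => (hb n).ae_nonneg hp ht) hK hF hΦ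
  have hbound : IsSpeedBound t σ g := by
    refine ⟨hgp, fun a b ha hab hbt => ?_⟩
    have ha' : a ∈ Icc 0 t := ⟨ha, hab.trans hbt⟩
    have hb' : b ∈ Icc 0 t := ⟨ha.trans hab, hbt⟩
    rw [hgF a b ha hab hbt]
    refine dist_le_of_tendsto hp.le U (hσ a ha') (hσ b hb') hR
      (fun n => hmom _ (hσs n) (hK n) a ha') (fun n => hmom _ (hσs n) (hK n) b hb')
      ((hF b hb').sub (hF a ha')) fun n => ?_
    rw [intervalIntegral_sub_of_le ((hb n).intervalIntegrable hp ht) ha hab hbt]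
    exact (hb n).2 a b ha hab hbt
  have hadm : IsAdmissible μ t σ := by
    refine ⟨⟨g, hbound⟩, ?_⟩
    have h1 := hσ t ⟨ht, le_rfl⟩
    have h2 : Tendsto (fun n => (σs n t).1) U (𝓝 μ.1) := by
      simp only [(hσs _).2]
      exact tendsto_const_nhds
    exact Subtype.ext (tendsto_nhds_unique h1 h2)
  refine ⟨σ, hadm, ?_⟩
  have hVlim : Tendsto (fun n => ∫ s in (0 : ℝ)..t, V (σs n s)) U
      (𝓝 (∫ s in (0 : ℝ)..t, V (σ s))) := by
    refine tendsto_intervalIntegral_of_equicontinuous ht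
      (fun n => hV.continuousOn_comp hp ht (hσs n).1) (hV.continuousOn_comp hp ht hadm.1) ?_
      fun s hs => hV.tendsto (hσ s hs)
    intro ε hε
    obtain ⟨δ, hδ, H⟩ := hV.exists_modulus hp ht μ K hε
    exact ⟨δ, hδ, fun n => H _ (hσs n) (hK n)⟩
  -- The limit contains `Φ t` rather than the energy of `σ`; the latter is no larger, since `g` is a
  -- speed bound for `σ`.
  have hact : Tendsto (fun n => action G V t (σs n)) U
      (𝓝 (G (σ 0) + (1 / p * Φ t - ∫ s in (0 : ℝ)..t, V (σ s)))) := by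
    simp only [fun n => action_eq hp ht G hV (hσs n).1]
    exact (hG.tendsto (hσ 0 ⟨le_rfl, ht⟩)).add
      (((hΦ t ⟨ht, le_rfl⟩).const_mul _).sub hVlim)
  have hveq := tendsto_nhds_unique hact (hv.mono_left Nat.hyperfilter_le_atTop)
  rw [action_eq hp ht G hV hadm.1, ← hveq]
  have := (hbound.energy_le hp ht).trans hgΦ
  gcongr

theorem IsAdmissible.isMinimizingPath {G V : WassersteinSpace d p → ℝ} {μ : WassersteinSpace d p}
    {t : ℝ} {σ : ℝ → WassersteinSpace d p} (hσ : IsAdmissible μ t σ)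
    (h : ∀ τ, IsAdmissible μ t τ → action G V t σ ≤ action G V t τ) :
    IsMinimizingPath G V μ t σ :=
  ⟨hσ, le_antisymm (le_iInf₂ fun τ hτ => EReal.coe_le_coe_iff.2 (h τ hτ)) (iInf₂_le σ hσ)⟩

end WassersteinSpace

/-! ### Existence of a minimizing path -/

theorem corollary4p3 (d : ℕ) (p : ℝ) (hp : 1 < p)
    (G V : WassersteinSpace d p → ℝ)
    (hGLip : WassersteinSpace.IsLipschitz G)
    (α β : ℝ) (ϱ : WassersteinSpace d p)
    (hVgrowth : ∀ μ : WassersteinSpace d p,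
      V μ ≤ α * WassersteinSpace.dist μ ϱ ^ p + β)
    (hG : WassersteinSpace.NarrowlyContinuous G)
    (hV : WassersteinSpace.NarrowlyContinuous V)
    (T : ℝ) (hT : p * (2 * WassersteinSpace.poincareConst d p * T) ^ p * α < 1)
    (μ : WassersteinSpace d p) (t : ℝ) (ht : t ∈ Set.Icc (0 : ℝ) T) :
    ∃ σ : ℝ → WassersteinSpace d p, WassersteinSpace.IsMinimizingPath G V μ t σ := by
  open WassersteinSpace in
  rcases ht.1.eq_or_lt with rfl | ht0
  -- At time zero every admissible path has action `G μ`.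
  · refine ⟨_, (isAdmissible_const hp 0 μ).isMinimizingPath fun τ hτ => le_of_eq ?_⟩
    simp [action, hτ.2]
  obtain ⟨C, hC, hPoin, hCT⟩ := exists_poincare_constant d hp hT
  -- Coercivity needs a nonnegative growth constant; replacing `α` by `max α 0` keeps both the
  -- growth and the smallness conditions.
  have hgrowth : ∀ ν : WassersteinSpace d p, V ν ≤ max α 0 * dist ν ϱ ^ p + β := fun ν =>
    (hVgrowth ν).trans (add_le_add_left (mul_le_mul_of_nonneg_right (le_max_left _ _)
      (Real.rpow_nonneg (dist_nonneg _ _) p)) β)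
  have hsmall : p * (2 * C * t) ^ p * max α 0 < 1 := by
    rcases le_total α 0 with hα | hα
    · simp [max_eq_right hα]
    · rw [max_eq_left hα]
      refine lt_of_le_of_lt ?_ hCT
      have := ht.2
      gcongr
  obtain ⟨c, hc⟩ := exists_energy_le_action hp hGLip (le_max_right α 0) hgrowth hV ht0 hC hPoin
    hsmall μ
  let S : Set ℝ := {a | ∃ σ, IsAdmissible μ t σ ∧ action G V t σ = a}
  have hne : S.Nonempty := ⟨_, _, isAdmissible_const hp t μ, rfl⟩
  have hbdd : BddBelow S := by
    refine ⟨-c, ?_⟩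
    rintro _ ⟨σ, hσ, rfl⟩
    have h1 := hc σ hσ
    have h2 := hσ.1.energy_nonneg hp ht.1
    have h3 : 0 ≤ 1 / (4 * p) * energy t σ := by positivity
    linarith
  obtain ⟨u, hu, hulim, huS⟩ := exists_seq_tendsto_sInf hne hbdd
  choose σs hσs hact using huS
  -- The minimizing values decrease, so the first one bounds all energies through coercivity.
  have henergy : ∀ n, energy t (σs n) ≤ 4 * p * (u 0 + c) := by
    intro n
    have h1 := hc _ (hσs n)
    have h2 : u n ≤ u 0 := hu (Nat.zero_le n)
    have h3 : energy t (σs n) = 4 * p * (1 / (4 * p) * energy t (σs n)) := by field_simp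
    rw [h3]
    rw [hact n] at h1
    gcongr
    linarith
  obtain ⟨σ, hσ, hle⟩ := exists_admissible_action_le hp hG hV ht.1 hσs henergy (v := sInf S)
    (by simpa only [hact] using hulim)
  exact ⟨σ, hσ.isMinimizingPath fun τ hτ => hle.trans (csInf_le hbdd ⟨τ, hτ, rfl⟩)⟩
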